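/- Let $E$ be a countable set (with the discrete $\sigma$-field), $(G,\mathcal G)$ a measurable space, $\beta$ a probability measure on $G$ and $f:E\times G\to E$ a measurable map. Let $V$ denote a random variable of law $\beta$. Let $\Pi$ be the Markov kernel on $E$ such that $\Pi(x,\cdot)$ is the law of $f(x,V)$, and $\Pi_2$ the Markov kernel on $E^2$ such that $\Pi_2((x,y),\cdot)$ is the law of $(f(x,V),f(y,V))$. Let $D=\{(x,x):x\in E\}$ be the diagonal of $E^2$. Two states $x,y\in E$ are called *accordables* if $D$ is accessible from $(x,y)$ for $\Pi_2$, i.e. if $\Pi_2^{\,l}((x,y),D)>0$ for some integer $l\ge 1$. A chain governed by $f$ and by a sequence $(V_n)_{n\in\mathbf Z}$ of independent random variables of law $\beta$ is a process $(X_n)_{n\in\mathbf Z}$ with values in $E$, defined on the same probability space, such that for every $n\in\mathbf Z$, $V_{n+1}$ is independent of $(X_k,V_k)_{k\le n}$ and $X_{n+1}=f(X_n,V_{n+1})$ almost surely. For a process $Z=(Z_n)_{n\in\mathbf Z}$, let $\mathcal F^Z_n$ be the completion of the $\sigma$-field generated by $(Z_k)_{k\le n}$; a process indexed by $\mathbf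 Z$ is stationary if its law is invariant under time shifts. **Theorem.** Suppose that $\Pi$ is irreducible and positive recurrent (from every state, the return to that state is almost sure and has finite mean time). Then the following conditions are equivalent: 1. Any two points of $E$ are accordables. 2. For every stationary chain $X=(X_n)_{n\in\mathbf Z}$ governed by $f$ and by a sequence $V=(V_n)_{n\in\mathbf Z}$ of independent random variables of law $\beta$, on any probability space, one has $\mathcal F^X_n\subset\mathcal F^V_n$ for all $n\in\mathbf Z$. 3. Every stationary Markov chain $(X_n,Y_n)_{n\in\mathbf Z}$ with kernel $\Pi_2$ lives on the diagonal: almost surely, $(X_n,Y_n)\in D$ for all $n\in\mathbf Z$. -/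

import Mathlib

open MeasureTheory ProbabilityTheory Filter
open scoped ENNReal

universe u v

namespace ConstructiveChain

/-- The transition kernel of the recursion `X_{n+1} = f (X_n, V_{n+1})` with innovations of law `β`:
from the state `x`, the next state has the law of `f (x, V)`, where `V` has law `β`. -/
noncomputable def recursionKernel {S G : Type*} [MeasurableSpace S] [Countable S]
    [MeasurableSingletonClass S] [MeasurableSpace G] (f : S × G → S) (β : Measure G) :
    Kernel S S where
  toFun x := β.map (fun v => f (x, v))
  measurable' := measurable_of_countable _

/-- Two copies of the recursion driven by the same innovation. -/
def coupledMap {E G : Type*} (f : E × G → E) : (E × E) × G → E × E :=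
  fun q => (f (q.1.1, q.2), f (q.1.2, q.2))

/-- `firstPassageProb κ y n x` is the probability that a chain with kernel `κ` started at `x`
visits `y` at time `n`, for the first time among the times `≥ 1`. -/
noncomputable def firstPassageProb {S : Type*} [MeasurableSpace S] (κ : Kernel S S) (y : S) :
    ℕ → S → ℝ≥0∞
  | 0, _ => 0
  | 1, x => κ x {y}
  | n + 2, x => ∫⁻ z in {y}ᶜ, firstPassageProb κ y (n + 1) z ∂(κ x)

/-- A kernel is positive recurrent if, from every state, the return to this state is almost sure
and the mean return time is finite. -/
def IsPositiveRecurrent {S : Type*} [MeasurableSpace S] (κ : Kernel S S) : Prop :=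
  ∀ x : S, ∑' n : ℕ, firstPassageProb κ x n x = 1 ∧
    ∑' n : ℕ, (n : ℝ≥0∞) * firstPassageProb κ x n x < ∞

/-- The states `x` and `y` are "accordables": the diagonal is accessible from `(x, y)` in at
least one step for the coupled kernel. -/
def Accordable {E G : Type*} [MeasurableSpace E] [Countable E] [MeasurableSingletonClass E]
    [MeasurableSpace G] (f : E × G → E) (β : Measure G) (x y : E) : Prop :=
  ∃ l : ℕ, 1 ≤ l ∧ 0 < (recursionKernel (coupledMap f) β ^ l) (x, y) (Set.diagonal E)

/-- The σ-field generated by `Z_k`, `k ≤ n`. -/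
abbrev past {Ω S : Type*} [MeasurableSpace S] (Z : ℤ → Ω → S) (n : ℤ) : MeasurableSpace Ω :=
  ⨆ k : ℤ, ⨆ _ : k ≤ n, MeasurableSpace.comap (Z k) inferInstance

/-- The completion of the σ-field generated by `Z_k`, `k ≤ n`: the sets that are almost surely
equal to a set of this σ-field. -/
abbrev completedPast {Ω S : Type*} [MeasurableSpace Ω] [MeasurableSpace S] (P : Measure Ω)
    (Z : ℤ → Ω → S) (n : ℤ) : MeasurableSpace Ω :=
  eventuallyMeasurableSpace (past Z n) (ae P)

/-- A process indexed by `ℤ` is stationary if its law is invariant under time shifts. -/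
def IsStationary {Ω S : Type*} [MeasurableSpace Ω] [MeasurableSpace S] (P : Measure Ω)
    (Z : ℤ → Ω → S) : Prop :=
  ∀ k : ℤ, P.map (fun ω n => Z (n + k) ω) = P.map (fun ω n => Z n ω)

/-- `Z` is a Markov chain indexed by `ℤ` with transition kernel `κ`: the conditional law of
`Z_{n+1}` given `(Z_k)_{k ≤ n}` is `κ (Z_n, ·)`. -/
structure IsMarkovChain {Ω S : Type*} [MeasurableSpace Ω] [MeasurableSpace S] (P : Measure Ω)
    (κ : Kernel S S) (Z : ℤ → Ω → S) : Prop where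
  measurable : ∀ n, Measurable (Z n)
  condLaw : ∀ (n : ℤ) (A : Set Ω) (s : Set S), MeasurableSet[past Z n] A → MeasurableSet s →
    P (A ∩ Z (n + 1) ⁻¹' s) = ∫⁻ ω in A, κ (Z n ω) s ∂P

/-- `X` is a chain indexed by `ℤ`, governed by `f` and by the sequence `V` of independent
innovations of law `β`. -/
structure IsGoverned {Ω E G : Type*} [MeasurableSpace Ω] [MeasurableSpace E] [MeasurableSpace G]
    (P : Measure Ω) (f : E × G → E) (β : Measure G) (X : ℤ → Ω → E) (V : ℤ → Ω → G) : Prop where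
  measurable_chain : ∀ n, Measurable (X n)
  measurable_innovation : ∀ n, Measurable (V n)
  law_innovation : ∀ n, P.map (V n) = β
  iIndep_innovation : iIndepFun V P
  indep_past : ∀ n : ℤ, Indep (MeasurableSpace.comap (V (n + 1)) inferInstance)
    (past (fun k ω => (X k ω, V k ω)) n) P
  recursion : ∀ n : ℤ, ∀ᵐ ω ∂P, X (n + 1) ω = f (X n ω, V (n + 1) ω)

end ConstructiveChain

/-! The diagonal `D` absorbs two copies of the recursion driven by the same innovations, so the
probability of being in `D` increases with time. The proof compares this merging with an invariant
probability `π` of `Π`.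

From 1: an invariant law on `E × E` cannot charge a point off `D`, since that point would leak mass
into `D`, which never gives any back; this yields 3. For 2, couple from the past: start a second
copy at time `k - m` from a fixed state charged by the stationary law. Its value at time `k` depends
on the innovations only, and it equals `X k` with probability tending to 1 as `m` grows
(`tendsto_coupled_pow_compl_diagonal`). Indeed each coordinate of the pair is dominated by a
multiple of `π`, so the pair is tight, and on a finite set of pairs the merging probability is
bounded below.

Towards 1: positive recurrence provides `π`, the normalized occupation measure of an excursion, and
irreducibility makes it charge every state. If `D` is not accessible from `(x, y)`, Cesàro means of
the laws of the pair are tight and have an invariant limit that does not charge `D`, against 3.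
Under 2, `{X 0 = x}` is approximated by an event depending on finitely many innovations, which is
independent of a remote `X (-m)`. Conditioning on `X (-m) = x` and on `X (-m) = y` shows that the
orbits of `x` and `y` both end at `x` on most of this event, so they merge with positive
probability. Both arguments need an invariant law to be realized by a chain governed over all of `ℤ`
(`exists_isGoverned`); it is built by drawing the past backwards from the conditional law of `(X n,
V (n + 1))` given `X (n + 1)`. -/

namespace ConstructiveChain

open scoped Topology symmDiff

/-! ### Transition kernels, their powers, and orbits of the recursion -/

section Recursion

variable {S G : Type*} [MeasurableSpace S] [Countable S] [MeasurableSingletonClass S]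
  [MeasurableSpace G] {g : S × G → S} {β : Measure G}

lemma recursionKernel_apply (g : S × G → S) (β : Measure G) (s : S) :
    recursionKernel g β s = β.map (fun v => g (s, v)) := rfl

lemma isMarkovKernel_recursionKernel (hg : Measurable g) [IsProbabilityMeasure β] :
    IsMarkovKernel (recursionKernel g β) :=
  ⟨fun s => by
    rw [recursionKernel_apply]
    exact Measure.isProbabilityMeasure_map (by fun_prop)⟩

/-- Translates invariance under the kernel into the statement that `g` maps `μ ⊗ β` to `μ`, the form
used to reverse time. -/
lemma bind_recursionKernel (hg : Measurable g) [SFinite β] (μ : Measure S) [SFinite μ] :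
    μ.bind (recursionKernel g β) = (μ.prod β).map g := by
  ext t ht
  rw [Measure.bind_apply ht (Kernel.aemeasurable _), Measure.map_apply hg ht,
    Measure.prod_apply (hg ht)]
  refine lintegral_congr fun s => ?_
  rw [recursionKernel_apply, Measure.map_apply (by fun_prop) ht]
  rfl

lemma lintegral_recursionKernel (hg : Measurable g) (h : S → ℝ≥0∞) (s : S) :
    ∫⁻ t, h t ∂(recursionKernel g β s) = ∫⁻ v, h (g (s, v)) ∂β := by
  rw [recursionKernel_apply, lintegral_map (measurable_of_countable h) (by fun_prop)]

end Recursion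

section KernelPow

variable {S : Type*} [MeasurableSpace S] {κ : Kernel S S}

lemma isMarkovKernel_pow [IsMarkovKernel κ] (n : ℕ) : IsMarkovKernel (κ ^ n) := by
  induction n with
  | zero => exact inferInstanceAs (IsMarkovKernel (Kernel.id : Kernel S S))
  | succ n ih =>
    rw [Kernel.pow_add, pow_one]
    infer_instance

lemma bind_pow_succ (μ : Measure S) (n : ℕ) :
    μ.bind (κ ^ (n + 1)) = (μ.bind (κ ^ n)).bind κ := by
  rw [add_comm, Kernel.pow_add, pow_one, ← Measure.comp_assoc]

lemma bind_pow_zero (μ : Measure S) : μ.bind (κ ^ 0 : Kernel S S) = μ :=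
  Measure.id_comp

lemma invariant_pow {μ : Measure S} (h : Kernel.Invariant κ μ) (n : ℕ) :
    μ.bind (κ ^ n) = μ := by
  induction n with
  | zero => exact bind_pow_zero μ
  | succ n ih => rw [bind_pow_succ, ih, h.def]

/-- Starting from a point charged by `μ` costs at most the factor `(μ {s})⁻¹`. -/
lemma measure_singleton_mul_le_bind [MeasurableSingletonClass S] (η : Kernel S S) (μ : Measure S)
    (s : S) {A : Set S} (hA : MeasurableSet A) : μ {s} * η s A ≤ μ.bind η A := by
  rw [Measure.bind_apply hA (Kernel.aemeasurable _), mul_comm,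
    ← lintegral_singleton (fun t => η t A)]
  exact setLIntegral_le_lintegral _ _

lemma measure_singleton_mul_pow_le [MeasurableSingletonClass S] {μ : Measure S}
    (h : Kernel.Invariant κ μ) (s : S) (n : ℕ) {A : Set S} (hA : MeasurableSet A) :
    μ {s} * (κ ^ n) s A ≤ μ A :=
  (measure_singleton_mul_le_bind _ μ s hA).trans_eq (by rw [invariant_pow h])

end KernelPow

section Orbit

variable {S G : Type*}

/-- The recursion `s ↦ g (s, v n)` iterated from the state `s`. -/
def orbit (g : S × G → S) (v : ℕ → G) (s : S) : ℕ → S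
  | 0 => s
  | n + 1 => g (orbit g v s n, v n)

lemma orbit_coupledMap (f : S × G → S) (v : ℕ → G) (z : S × S) (n : ℕ) :
    orbit (coupledMap f) v z n = (orbit f v z.1 n, orbit f v z.2 n) := by
  induction n with
  | zero => rfl
  | succ n ih => simp [orbit, ih, coupledMap]

lemma measurable_orbit {Ω : Type*} {m : MeasurableSpace Ω} [MeasurableSpace S] [MeasurableSpace G]
    {g : S × G → S} (hg : Measurable g) {V : ℕ → Ω → G} {Z : Ω → S} (hZ : Measurable Z) (n : ℕ)
    (hV : ∀ i < n, Measurable (V i)) : Measurable (fun ω => orbit g (fun i => V i ω) (Z ω) n) := by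
  induction n with
  | zero => exact hZ
  | succ n ih =>
    exact hg.comp ((ih fun i hi => hV i (by lia)).prodMk (hV n (by lia)))

/-- If each innovation is independent of the past, the `n`-th state of the recursion has the law
obtained from the initial law by applying `n` times the transition kernel. -/
lemma map_orbit {Ω : Type*} [mΩ : MeasurableSpace Ω] {P : Measure Ω} [IsProbabilityMeasure P]
    [MeasurableSpace S] [Countable S] [MeasurableSingletonClass S] [MeasurableSpace G]
    {g : S × G → S} (hg : Measurable g) {β : Measure G} [IsProbabilityMeasure β]
    {V : ℕ → Ω → G} {Z : Ω → S} {m : ℕ → MeasurableSpace Ω} (hm : ∀ n, m n ≤ mΩ)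
    (hmono : Monotone m) (hZ : Measurable[m 0] Z) (hV : ∀ n, Measurable[m (n + 1)] (V n))
    (hlaw : ∀ n, P.map (V n) = β)
    (hind : ∀ n, Indep (MeasurableSpace.comap (V n) inferInstance) (m n) P) (n : ℕ) :
    P.map (fun ω => orbit g (fun i => V i ω) (Z ω) n)
      = (P.map Z).bind (recursionKernel g β ^ n) := by
  have hmeas : ∀ n, Measurable[m n] (fun ω => orbit g (fun i => V i ω) (Z ω) n) := fun n =>
    measurable_orbit (m := m n) hg (hZ.mono (hmono (Nat.zero_le n)) le_rfl) n
      fun i hi => (hV i).mono (hmono hi) le_rfl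
  induction n with
  | zero => rw [bind_pow_zero]; rfl
  | succ n ih =>
    have hprod := (indepFun_iff_map_prod_eq_prod_map_map (μ := P)
      ((hmeas n).mono (hm n) le_rfl).aemeasurable
      ((hV n).mono (hm _) le_rfl).aemeasurable).1
      (indep_of_indep_of_le_right (hind n) (hmeas n).comap_le).symm
    have : IsProbabilityMeasure (P.map Z) :=
      Measure.isProbabilityMeasure_map (hZ.mono (hm 0) le_rfl).aemeasurable
    have := isMarkovKernel_recursionKernel hg (β := β)
    have := isMarkovKernel_pow (κ := recursionKernel g β) n
    rw [bind_pow_succ, bind_recursionKernel hg, ← ih, ← hlaw n, ← hprod,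
      Measure.map_map hg (((hmeas n).mono (hm n) le_rfl).prodMk ((hV n).mono (hm _) le_rfl))]
    rfl

end Orbit

/-! ### The coupled kernel: its marginals and the absorbing diagonal -/

section Coupling

lemma measurable_coupledMap {E G : Type*} [MeasurableSpace E] [MeasurableSpace G] {f : E × G → E}
    (hf : Measurable f) : Measurable (coupledMap f) := by
  unfold coupledMap
  fun_prop

variable {E G : Type*} [MeasurableSpace E] [Countable E] [DiscreteMeasurableSpace E]
  [MeasurableSpace G] {f : E × G → E} {β : Measure G}

lemma coupled_pow_fst (hf : Measurable f) (n : ℕ) (z : E × E) (A : Set E) :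
    (recursionKernel (coupledMap f) β ^ n) z (Prod.fst ⁻¹' A) =
      (recursionKernel f β ^ n) z.1 A := by
  induction n generalizing z with
  | zero =>
    change Kernel.id z _ = Kernel.id z.1 _
    simp only [Kernel.id_apply, Measure.dirac_apply]
    rfl
  | succ n ih =>
    rw [add_comm, Kernel.pow_add_apply_eq_lintegral _ _ _ _ .of_discrete,
      Kernel.pow_add_apply_eq_lintegral _ _ _ _ .of_discrete, pow_one, pow_one,
      lintegral_recursionKernel (measurable_coupledMap hf), lintegral_recursionKernel hf]
    exact lintegral_congr fun v => ih _

lemma coupled_pow_snd (hf : Measurable f) (n : ℕ) (z : E × E) (A : Set E) :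
    (recursionKernel (coupledMap f) β ^ n) z (Prod.snd ⁻¹' A) =
      (recursionKernel f β ^ n) z.2 A := by
  induction n generalizing z with
  | zero =>
    change Kernel.id z _ = Kernel.id z.2 _
    simp only [Kernel.id_apply, Measure.dirac_apply]
    rfl
  | succ n ih =>
    rw [add_comm, Kernel.pow_add_apply_eq_lintegral _ _ _ _ .of_discrete,
      Kernel.pow_add_apply_eq_lintegral _ _ _ _ .of_discrete, pow_one, pow_one,
      lintegral_recursionKernel (measurable_coupledMap hf), lintegral_recursionKernel hf]
    exact lintegral_congr fun v => ih _

variable [IsProbabilityMeasure β]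

lemma coupled_pow_diagonal (hf : Measurable f) (n : ℕ) {z : E × E} (hz : z ∈ Set.diagonal E) :
    (recursionKernel (coupledMap f) β ^ n) z (Set.diagonal E) = 1 := by
  induction n generalizing z with
  | zero =>
    change Kernel.id z _ = 1
    simp [Kernel.id_apply, hz]
  | succ n ih =>
    rw [add_comm, Kernel.pow_add_apply_eq_lintegral _ _ _ _ .of_discrete, pow_one,
      lintegral_recursionKernel (measurable_coupledMap hf)]
    have : ∀ v, coupledMap f (z, v) ∈ Set.diagonal E := fun v => by
      rw [Set.mem_diagonal_iff] at hz
      simp [coupledMap, hz]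
    simp [ih (this _)]

/-- The diagonal is absorbing. This lets different accessibility times be replaced by a common
larger one, and time 0 by a time at least 1. -/
lemma coupled_pow_diagonal_mono (hf : Measurable f) (z : E × E) :
    Monotone fun n => (recursionKernel (coupledMap f) β ^ n) z (Set.diagonal E) := by
  refine monotone_nat_of_le_succ fun n => ?_
  rw [Kernel.pow_add_apply_eq_lintegral _ _ _ _ .of_discrete,
    ← lintegral_indicator_one .of_discrete]
  refine lintegral_mono fun w => ?_
  by_cases hw : w ∈ Set.diagonal E
  · simp only [Set.indicator_of_mem hw]
    exact (coupled_pow_diagonal hf 1 hw).ge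
  · simp only [Set.indicator_of_notMem hw]
    exact zero_le

end Coupling

/-! ### Independence, pasts of processes, and governed chains -/

section Independence

variable {Ω : Type*} [mΩ : MeasurableSpace Ω] {P : Measure Ω} [IsProbabilityMeasure P]

/-- Probabilities of triple intersections factorize, and the sets `b ∩ c` form a π-system generating
`m₂ ⊔ m₃`. -/
lemma indep_sup_of_indep_sup {m₁ m₂ m₃ : MeasurableSpace Ω} (h₁ : m₁ ≤ mΩ) (h₂ : m₂ ≤ mΩ)
    (h₃ : m₃ ≤ mΩ) (h₁₂ : Indep m₁ m₂ P) (h : Indep (m₁ ⊔ m₂) m₃ P) : Indep m₁ (m₂ ⊔ m₃) P := by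
  have hgen : m₂ ⊔ m₃ = MeasurableSpace.generateFrom
      {t | ∃ b c, MeasurableSet[m₂] b ∧ MeasurableSet[m₃] c ∧ b ∩ c = t} := by
    apply le_antisymm
    · refine sup_le (fun b hb => ?_) (fun c hc => ?_)
      · exact MeasurableSpace.measurableSet_generateFrom
          ⟨b, Set.univ, hb, MeasurableSet.univ, by simp⟩
      · exact MeasurableSpace.measurableSet_generateFrom
          ⟨Set.univ, c, MeasurableSet.univ, hc, by simp⟩
    · refine MeasurableSpace.generateFrom_le ?_
      rintro _ ⟨b, c, hb, hc, rfl⟩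
      exact MeasurableSet.inter (m := m₂ ⊔ m₃) ((le_sup_left : m₂ ≤ m₂ ⊔ m₃) _ hb)
        ((le_sup_right : m₃ ≤ m₂ ⊔ m₃) _ hc)
  refine IndepSets.indep h₁ (sup_le h₂ h₃) (@MeasurableSpace.isPiSystem_measurableSet Ω m₁) ?_
    (@MeasurableSpace.generateFrom_measurableSet Ω m₁).symm hgen ?_
  · rintro _ ⟨b, c, hb, hc, rfl⟩ _ ⟨b', c', hb', hc', rfl⟩ -
    exact ⟨b ∩ b', c ∩ c', hb.inter hb', hc.inter hc', by ac_rfl⟩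
  · rw [IndepSets_iff]
    rintro a _ ha ⟨b, c, hb, hc, rfl⟩
    rw [Indep_iff] at h h₁₂
    have ha' : MeasurableSet[m₁ ⊔ m₂] a := (le_sup_left : m₁ ≤ m₁ ⊔ m₂) _ ha
    have hb' : MeasurableSet[m₁ ⊔ m₂] b := (le_sup_right : m₂ ≤ m₁ ⊔ m₂) _ hb
    rw [← Set.inter_assoc, h _ _ (ha'.inter hb') hc, h₁₂ _ _ ha hb, h _ _ hb' hc, mul_assoc]

end Independence

section Past

variable {Ω S : Type*} [MeasurableSpace S] {Z : ℤ → Ω → S}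

lemma past_le {mΩ : MeasurableSpace Ω} (hZ : ∀ n, Measurable (Z n)) (n : ℤ) : past Z n ≤ mΩ :=
  iSup₂_le fun k _ => (hZ k).comap_le

lemma measurable_past {k n : ℤ} (h : k ≤ n) : Measurable[past Z n] (Z k) :=
  measurable_iff_comap_le.2 (le_iSup₂_of_le k h le_rfl)

lemma past_mono : Monotone (past Z) := fun _ _ h =>
  iSup₂_le fun k hk => le_iSup₂_of_le k (hk.trans h) le_rfl

/-- Random variables, each of which is independent of the earlier ones, are independent. -/
lemma iIndepFun_of_indep_past [MeasurableSpace Ω] {P : Measure Ω} [IsProbabilityMeasure P]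
    {V : ℤ → Ω → S}
    (h : ∀ n : ℤ, Indep (MeasurableSpace.comap (V (n + 1)) inferInstance) (past V n) P) :
    iIndepFun V P := by
  rw [iIndepFun_iff_measure_inter_preimage_eq_mul]
  intro I
  induction I using Finset.induction_on_max with
  | empty => intro; simp
  | insert a I ha ih =>
    intro sets hsets
    have haI : a ∉ I := fun h => lt_irrefl _ (ha a h)
    rw [Finset.prod_insert haI, ← ih fun i hi => hsets i (Finset.mem_insert_of_mem hi),
      Finset.set_biInter_insert]
    have h' := h (a - 1)
    rw [sub_add_cancel, Indep_iff] at h'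
    refine h' _ _ ⟨_, hsets a (Finset.mem_insert_self _ _), rfl⟩ ?_
    refine Finset.measurableSet_biInter (m := past V (a - 1)) _ fun i hi => ?_
    exact measurable_past (by have := ha i hi; lia) (hsets i (Finset.mem_insert_of_mem hi))

variable {T : Type*} [MeasurableSpace T] {X : ℤ → Ω → S} {V : ℤ → Ω → T}

lemma measurable_chain_past {k n : ℤ} (hk : k ≤ n) :
    Measurable[past (fun k ω => (X k ω, V k ω)) n] (X k) :=
  measurable_fst.comp (measurable_past (Z := fun k ω => (X k ω, V k ω)) hk)

lemma measurable_innovation_past {k n : ℤ} (hk : k ≤ n) :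
    Measurable[past (fun k ω => (X k ω, V k ω)) n] (V k) :=
  measurable_snd.comp (measurable_past (Z := fun k ω => (X k ω, V k ω)) hk)

end Past

namespace IsGoverned

variable {Ω E G : Type*} [mΩ : MeasurableSpace Ω] [MeasurableSpace E] [MeasurableSpace G]
  {P : Measure Ω} {f : E × G → E} {β : Measure G} {X : ℤ → Ω → E} {V : ℤ → Ω → G}

lemma past_pair_le (h : IsGoverned P f β X V) (n : ℤ) :
    past (fun k ω => (X k ω, V k ω)) n ≤ mΩ :=
  past_le (fun k => (h.measurable_chain k).prodMk (h.measurable_innovation k)) n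

lemma ae_eq_orbit (h : IsGoverned P f β X V) (n : ℤ) (m : ℕ) :
    ∀ᵐ ω ∂P, X (n + m) ω = orbit f (fun i => V (n + i + 1) ω) (X n ω) m := by
  induction m with
  | zero => simp [orbit]
  | succ m ih =>
    filter_upwards [ih, h.recursion (n + m)] with ω h₁ h₂
    rw [orbit, ← h₁, ← h₂]
    push_cast
    rw [add_assoc]

/-- The innovations after time `n` are independent of the past at time `n`. -/
lemma indep_future [IsProbabilityMeasure P] (h : IsGoverned P f β X V) (n : ℤ) (m : ℕ) :
    Indep (past (fun k ω => (X k ω, V k ω)) n)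
      (⨆ i : ℕ, ⨆ _ : i < m, MeasurableSpace.comap (V (n + i + 1)) inferInstance) P := by
  induction m with
  | zero => simpa using indep_bot_right _
  | succ m ih =>
    have hsucc : (⨆ i : ℕ, ⨆ _ : i < m + 1, MeasurableSpace.comap (V (n + i + 1)) inferInstance)
        = (⨆ i : ℕ, ⨆ _ : i < m, MeasurableSpace.comap (V (n + i + 1)) inferInstance)
          ⊔ MeasurableSpace.comap (V (n + m + 1)) inferInstance :=
      Nat.iSup_lt_succ (fun i : ℕ => MeasurableSpace.comap (V (n + i + 1)) inferInstance) m
    rw [hsucc]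
    refine indep_sup_of_indep_sup (h.past_pair_le n)
      (iSup₂_le fun i _ => (h.measurable_innovation _).comap_le)
      (h.measurable_innovation _).comap_le ih ?_
    refine (indep_of_indep_of_le_right (h.indep_past (n + m)) (sup_le (past_mono (by lia)) ?_)).symm
    exact iSup₂_le fun i hi => (measurable_innovation_past (by lia)).comap_le

lemma map_orbit {S : Type*} [MeasurableSpace S] [Countable S] [MeasurableSingletonClass S]
    [IsProbabilityMeasure P] [IsProbabilityMeasure β]
    (h : IsGoverned P f β X V) {g : S × G → S} (hg : Measurable g) {n : ℤ} {Z : Ω → S}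
    (hZ : Measurable[past (fun k ω => (X k ω, V k ω)) n] Z) (m : ℕ) :
    P.map (fun ω => orbit g (fun i => V (n + i + 1) ω) (Z ω) m)
      = (P.map Z).bind (recursionKernel g β ^ m) := by
  refine ConstructiveChain.map_orbit (V := fun i => V (n + i + 1)) hg
    (m := fun i => past (fun k ω => (X k ω, V k ω)) (n + i)) (fun i => h.past_pair_le _)
    (fun i j hij => past_mono (by gcongr)) (by rwa [Nat.cast_zero, add_zero]) (fun i => ?_)
    (fun i => h.law_innovation _) (fun i => h.indep_past _) m
  exact measurable_innovation_past (by push_cast; lia)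

lemma isMarkovChain [Countable E] [MeasurableSingletonClass E] [IsProbabilityMeasure P]
    [IsProbabilityMeasure β] (hf : Measurable f) (h : IsGoverned P f β X V) :
    IsMarkovChain P (recursionKernel f β) X where
  measurable := h.measurable_chain
  condLaw n A s hA hs := by
    have hle : past X n ≤ past (fun k ω => (X k ω, V k ω)) n :=
      iSup₂_le fun k hk => (measurable_chain_past hk).comap_le
    have hA' : MeasurableSet A := h.past_pair_le n _ (hle _ hA)
    have hX := h.measurable_chain
    have hV := h.measurable_innovation
    have hind := h.indep_past n
    rw [Indep_iff] at hind
    -- The next innovation is independent of `A ∩ {X n ∈ s}`, so restricting to `A` preserves the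
    -- product structure of `(X n, V (n + 1))`.
    have hprod : ((P.restrict A).map (X n)).prod β
        = (P.restrict A).map (fun ω => (X n ω, V (n + 1) ω)) := by
      refine Measure.prod_eq fun s t hs ht => ?_
      rw [Measure.map_apply ((hX n).prodMk (hV _)) (hs.prod ht), Measure.map_apply (hX n) hs,
        Measure.restrict_apply (((hX n).prodMk (hV _)) (hs.prod ht)),
        Measure.restrict_apply (hX n hs), ← h.law_innovation (n + 1),
        Measure.map_apply (hV _) ht, mul_comm, ← hind _ _ ⟨t, ht, rfl⟩
          (MeasurableSet.inter (measurable_chain_past le_rfl hs) (hle _ hA)), ← Set.inter_assoc]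
      congr 2
      ext ω
      simp [and_comm]
    have hlaw : (P.restrict A).map (X (n + 1))
        = ((P.restrict A).map (X n)).bind (recursionKernel f β) := by
      rw [bind_recursionKernel hf, hprod, Measure.map_map hf ((hX n).prodMk (hV _))]
      exact Measure.map_congr (ae_restrict_of_ae (h.recursion n))
    have := congrArg (fun ν => ν s) hlaw
    simp only [Measure.map_apply (hX _) hs, Measure.restrict_apply (hX _ hs),
      Measure.bind_apply hs (Kernel.aemeasurable _),
      lintegral_map (Kernel.measurable_coe _ hs) (hX _)] at this
    rw [Set.inter_comm, this]

end IsGoverned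

/-! ### Stationarity from constant marginals -/

section Stationarity

variable {Ω S : Type*} [MeasurableSpace Ω] [MeasurableSpace S] {P : Measure Ω}

lemma IsStationary.map_eq {Z : ℤ → Ω → S} (h : IsStationary P Z) (hZ : ∀ n, Measurable (Z n))
    (n : ℤ) : P.map (Z n) = P.map (Z 0) := by
  have := congrArg (fun ν => ν.map (fun z : ℤ → S => z 0)) (h n)
  rw [Measure.map_map (by fun_prop) (measurable_pi_lambda _ fun k => hZ _),
    Measure.map_map (by fun_prop) (measurable_pi_lambda _ fun k => hZ _)] at this
  simpa [Function.comp_def] using this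

variable [MeasurableSingletonClass S] {κ : Kernel S S} {Z : ℤ → Ω → S}

lemma IsMarkovChain.measure_window (h : IsMarkovChain P κ Z) (n : ℤ) (a : ℕ → S) (m : ℕ) :
    P {ω | ∀ i ≤ m, Z (n + i) ω = a i}
      = P.map (Z n) {a 0} * ∏ i ∈ Finset.range m, κ (a i) {a (i + 1)} := by
  induction m with
  | zero =>
    rw [Measure.map_apply (h.measurable n) (measurableSet_singleton _)]
    simp [Set.preimage]
  | succ m ih =>
    have hset : {ω | ∀ i ≤ m + 1, Z (n + i) ω = a i}
        = {ω | ∀ i ≤ m, Z (n + i) ω = a i} ∩ Z (n + m + 1) ⁻¹' {a (m + 1)} := by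
      ext ω
      simp only [Set.mem_ofPred_eq, Set.mem_inter_iff, Set.mem_preimage, Set.mem_singleton_iff]
      rw [show (n + m + 1 : ℤ) = n + (m + 1 : ℕ) by push_cast; ring]
      refine ⟨fun H => ⟨fun i hi => H i (by lia), H _ le_rfl⟩, fun H i hi => ?_⟩
      rcases Nat.le_succ_iff.1 hi with hi | rfl
      · exact H.1 i hi
      · exact H.2
    have hmeas : MeasurableSet[past Z (n + m)] {ω | ∀ i ≤ m, Z (n + i) ω = a i} := by
      simp only [Set.ofPred_forall]
      refine MeasurableSet.iInter fun i => MeasurableSet.iInter fun hi => ?_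
      exact measurable_past (by lia) (measurableSet_singleton (a i))
    rw [hset, h.condLaw _ _ _ hmeas (measurableSet_singleton _), Finset.prod_range_succ,
      ← mul_assoc, ← ih, mul_comm]
    rw [setLIntegral_congr_fun (g := fun _ => κ (a m) {a (m + 1)})
      (past_le h.measurable _ _ hmeas) (fun ω hω => by simp only [hω m le_rfl])]
    simp

/-- A Markov chain with countably many states is stationary if its one-dimensional marginals are
all equal. -/
lemma IsMarkovChain.isStationary [Countable S] [IsProbabilityMeasure P] (h : IsMarkovChain P κ Z)
    {μ : Measure S} (hμ : ∀ n, P.map (Z n) = μ) : IsStationary P Z := by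
  intro k
  have hshift : ∀ k : ℤ, Measurable (fun ω n => Z (n + k) ω) := fun k =>
    measurable_pi_lambda _ fun n => h.measurable _
  -- Probabilities of paths on a symmetric window do not involve the shift `k`; such windows contain
  -- every finite set of times, so they determine the law.
  have hwindow : ∀ (N : ℕ) (k : ℤ) (x : ℤ → S),
      (P.map (fun ω n => Z (n + k) ω)).map (Finset.Icc (-N : ℤ) N).restrict
          {(Finset.Icc (-N : ℤ) N).restrict x}
        = μ {x (-N)} * ∏ i ∈ Finset.range (2 * N), κ (x (-N + i)) {x (-N + (i + 1 : ℕ))} := by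
    intro N k x
    have := h.measure_window (-N + k) (fun i => x (-N + i)) (2 * N)
    rw [hμ, Nat.cast_zero, add_zero] at this
    rw [Measure.map_apply (by fun_prop) (measurableSet_singleton _),
      Measure.map_apply (hshift k) ((Finset.measurable_restrict _) (measurableSet_singleton _)),
      ← this]
    congr 1
    ext ω
    simp only [Set.mem_preimage, Set.mem_singleton_iff, funext_iff, Set.mem_ofPred_eq,
      Subtype.forall, Finset.mem_Icc, Finset.restrict]
    constructor
    · intro H i hi
      rw [← H (-N + i) (by lia), add_right_comm]
    · intro H j hj
      obtain ⟨i, rfl⟩ : ∃ i : ℕ, j = -N + (i : ℤ) := ⟨(j + N).toNat, by lia⟩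
      rw [← H i (by lia), add_right_comm]
  have : ∀ I : Finset ℤ, IsFiniteMeasure ((P.map (fun ω n => Z n ω)).map I.restrict) :=
    fun I => inferInstance
  refine IsProjectiveLimit.unique (P := fun I : Finset ℤ =>
    (P.map (fun ω n => Z n ω)).map I.restrict) (fun I => ?_) (fun I => rfl)
  obtain ⟨N, hN⟩ : ∃ N : ℕ, I ⊆ Finset.Icc (-N : ℤ) N := by
    refine ⟨I.sup Int.natAbs, fun i hi => ?_⟩
    have := Finset.le_sup (f := Int.natAbs) hi
    rw [Finset.mem_Icc]
    lia
  have hcomp : (I.restrict : (ℤ → S) → I → S)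
      = Finset.restrict₂ hN ∘ (Finset.Icc (-N : ℤ) N).restrict := rfl
  have hN' : (P.map (fun ω n => Z (n + k) ω)).map (Finset.Icc (-N : ℤ) N).restrict
      = (P.map (fun ω n => Z n ω)).map (Finset.Icc (-N : ℤ) N).restrict := by
    refine Measure.ext_of_singleton fun b => ?_
    obtain ⟨x, rfl⟩ : ∃ x : ℤ → S, (Finset.Icc (-N : ℤ) N).restrict x = b := by
      refine ⟨fun j => if hj : j ∈ Finset.Icc (-N : ℤ) N then b ⟨j, hj⟩ else b ⟨-N, by simp⟩, ?_⟩
      ext j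
      exact dif_pos j.2
    have h₀ := hwindow N 0 x
    simp only [add_zero] at h₀
    rw [hwindow N k x, h₀]
  rw [hcomp, ← Measure.map_map (Finset.measurable_restrict₂ hN) (Finset.measurable_restrict _), hN',
    Measure.map_map (Finset.measurable_restrict₂ hN) (Finset.measurable_restrict _)]
  rfl

end Stationarity

/-! ### Invariant probability of a positive recurrent chain -/

section InvariantMeasure

lemma tsum_firstPassageProb_succ {S : Type*} [MeasurableSpace S] (κ : Kernel S S) (x : S) :
    ∑' n, firstPassageProb κ x (n + 1) x = ∑' n, firstPassageProb κ x n x := by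
  rw [tsum_eq_zero_add' ENNReal.summable (f := fun n => firstPassageProb κ x n x)]
  simp [firstPassageProb]

variable {S : Type*} [MeasurableSpace S]

/-- The law of the chain at time `n`, restricted to the event that the chain started at `x` has
not come back to `x` up to time `n`. -/
noncomputable def tabooLaw (κ : Kernel S S) (x : S) : ℕ → Measure S
  | 0 => Measure.dirac x
  | n + 1 => ((tabooLaw κ x n).bind κ).restrict {x}ᶜ

variable [DiscreteMeasurableSpace S]

/-- Markov property of the chain killed at `x`: the first `n` steps, which avoid `x`, are moved from
the passage probability into the taboo law. -/
lemma lintegral_firstPassageProb (κ : Kernel S S) (x : S) (n m : ℕ) :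
    ∫⁻ z, firstPassageProb κ x (n + m + 1) z ∂(tabooLaw κ x 0)
      = ∫⁻ z, firstPassageProb κ x (m + 1) z ∂(tabooLaw κ x n) := by
  induction n generalizing m with
  | zero => rw [zero_add]
  | succ n ih =>
    rw [show n + 1 + m + 1 = n + (m + 1) + 1 by ring, ih (m + 1), tabooLaw,
      ← lintegral_indicator .of_discrete,
      Measure.lintegral_bind (Kernel.aemeasurable _) Measurable.of_discrete.aemeasurable]
    refine lintegral_congr fun z => ?_
    rw [firstPassageProb, lintegral_indicator .of_discrete]

lemma bind_tabooLaw_singleton (κ : Kernel S S) (x : S) (n : ℕ) :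
    (tabooLaw κ x n).bind κ {x} = firstPassageProb κ x (n + 1) x := by
  have := lintegral_firstPassageProb κ x n 0
  rw [tabooLaw, lintegral_dirac] at this
  rw [Measure.bind_apply .of_discrete (Kernel.aemeasurable _)]
  exact this.symm

lemma bind_tabooLaw (κ : Kernel S S) (x : S) (n : ℕ) :
    (tabooLaw κ x n).bind κ
      = tabooLaw κ x (n + 1) + firstPassageProb κ x (n + 1) x • Measure.dirac x := by
  rw [← bind_tabooLaw_singleton, ← Measure.restrict_singleton, tabooLaw, add_comm,
    Measure.restrict_add_restrict_compl .of_discrete]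

/-- For the return time `T`, this is `P (T > n) = ∑_{k > n} P (T = k)`: the mass lost at each step
is the first passage probability, and nothing is left over because return is almost sure. -/
lemma tabooLaw_univ (κ : Kernel S S) [IsMarkovKernel κ] {x : S}
    (hx : ∑' n, firstPassageProb κ x n x = 1) (n : ℕ) :
    tabooLaw κ x n Set.univ = ∑' k, firstPassageProb κ x (n + k + 1) x := by
  induction n with
  | zero => simp [tabooLaw, tsum_firstPassageProb_succ, hx]
  | succ n ih =>
    have h₁ : (tabooLaw κ x n).bind κ Set.univ = tabooLaw κ x n Set.univ := by
      rw [Measure.bind_apply .univ (Kernel.aemeasurable _)]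
      simp
    have hne : firstPassageProb κ x (n + 1) x ≠ ∞ := by
      refine ne_top_of_le_ne_top ENNReal.one_ne_top (hx ▸ ENNReal.le_tsum (n + 1))
    rw [bind_tabooLaw, ih, tsum_eq_zero_add' ENNReal.summable] at h₁
    simp only [Measure.coe_add, Measure.coe_smul, Pi.add_apply, Pi.smul_apply, measure_univ,
      smul_eq_mul, mul_one, add_zero] at h₁
    rw [add_comm (firstPassageProb _ _ _ _)] at h₁
    rw [(ENNReal.add_left_inj hne).1 h₁]
    refine tsum_congr fun k => ?_
    congr 1
    ring

/-- A positive recurrent kernel has an invariant probability measure. -/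
theorem exists_invariant_of_isPositiveRecurrent [Nonempty S] (κ : Kernel S S) [IsMarkovKernel κ]
    (h : IsPositiveRecurrent κ) :
    ∃ π : Measure S, IsProbabilityMeasure π ∧ Kernel.Invariant κ π := by
  obtain ⟨x⟩ := ‹Nonempty S›
  obtain ⟨hx, hmean⟩ := h x
  -- Occupation measure of one excursion from `x`. One step of `κ` drops the initial Dirac mass and
  -- restores it through the returns to `x`, of total probability 1.
  set ν : Measure S := Measure.sum (tabooLaw κ x) with hν
  have hinv : ν.bind κ = ν := by
    have : ν.bind κ = Measure.sum (fun n => (tabooLaw κ x n).bind κ) := by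
      ext s hs
      simp only [hν, Measure.bind_apply hs (Kernel.aemeasurable _), Measure.sum_apply _ hs,
        lintegral_sum_measure]
    ext s hs
    rw [this, Measure.sum_apply _ hs, hν, Measure.sum_apply _ hs,
      tsum_eq_zero_add' ENNReal.summable (f := fun n => tabooLaw κ x n s)]
    simp only [bind_tabooLaw, Measure.coe_add, Measure.coe_smul, Pi.add_apply, Pi.smul_apply,
      smul_eq_mul]
    rw [ENNReal.tsum_add, ENNReal.tsum_mul_right, tsum_firstPassageProb_succ, hx, one_mul, add_comm]
    rfl
  -- The identity `∑ P (T > n) = E T`, by exchanging the sums; the mean return time is what makes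
  -- `ν` normalizable.
  have hmass : ν Set.univ = ∑' n : ℕ, (n : ℝ≥0∞) * firstPassageProb κ x n x := by
    rw [hν, Measure.sum_apply _ .univ]
    calc ∑' n, tabooLaw κ x n Set.univ
        = ∑' n, ∑' m, (if n < m then firstPassageProb κ x m x else 0) := by
          refine tsum_congr fun n => ?_
          rw [tabooLaw_univ κ hx,
            ← ENNReal.summable.sum_add_tsum_nat_add' (k := n + 1)
              (f := fun m => if n < m then firstPassageProb κ x m x else 0), Finset.sum_eq_zero,
            zero_add]
          · refine tsum_congr fun k => ?_
            rw [if_pos (by lia), show k + (n + 1) = n + k + 1 by ring]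
          · intro i hi
            rw [if_neg]
            rw [Finset.mem_range] at hi
            lia
      _ = ∑' m, ∑' n, (if n < m then firstPassageProb κ x m x else 0) := ENNReal.tsum_comm
      _ = _ := by
          refine tsum_congr fun m => ?_
          rw [tsum_eq_sum (s := Finset.range m) fun n hn => if_neg (by simpa using hn),
            Finset.sum_congr rfl fun n hn => if_pos (Finset.mem_range.1 hn)]
          simp
  have hfin : ν Set.univ ≠ ∞ := hmass ▸ hmean.ne
  have hzero : ν Set.univ ≠ 0 := by
    have : tabooLaw κ x 0 Set.univ ≤ ν Set.univ := by
      rw [hν, Measure.sum_apply _ .univ]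
      exact ENNReal.le_tsum 0
    rw [tabooLaw, measure_univ] at this
    exact (zero_lt_one.trans_le this).ne'
  refine ⟨(ν Set.univ)⁻¹ • ν, ⟨?_⟩, ?_⟩
  · simp [ENNReal.inv_mul_cancel hzero hfin]
  · change Measure.bind _ _ = _
    rw [Measure.comp_smul, hinv]

/-- Some state is charged; irreducibility carries mass from it to `y`, and invariance keeps that
mass in `π`. -/
lemma measure_singleton_pos_of_irreducible [Countable S] {κ : Kernel S S}
    (hirr : Kernel.IsIrreducible Measure.count κ) {π : Measure S} [IsProbabilityMeasure π]
    (hπ : Kernel.Invariant κ π) (y : S) : 0 < π {y} := by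
  obtain ⟨x, hx⟩ : ∃ x, π {x} ≠ 0 := by
    by_contra! H
    have : π = 0 := Measure.ext_of_singleton fun a => by simp [H a]
    exact IsProbabilityMeasure.ne_zero π this
  obtain ⟨n, hn⟩ := hirr.irreducible (A := {y}) .of_discrete (by simp) x
  exact (ENNReal.mul_pos hx hn.ne').trans_le (measure_singleton_mul_pow_le hπ x n .of_discrete)

end InvariantMeasure

/-! ### Tightness of the coupled chain -/

section Tightness

lemma exists_finset_measure_compl_le {S : Type*} [MeasurableSpace S] [Countable S]
    [MeasurableSingletonClass S] (μ : Measure S) [IsFiniteMeasure μ] {ε : ℝ≥0∞} (hε : ε ≠ 0) :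
    ∃ K : Finset S, μ (K : Set S)ᶜ ≤ ε := by
  have hsum : ∑' s, μ {s} ≠ ∞ := by
    rw [← measure_iUnion (fun i j hij => by simpa using hij) fun s => measurableSet_singleton s]
    exact measure_ne_top _ _
  obtain ⟨K, hK⟩ := ((ENNReal.tendsto_tsum_compl_atTop_zero hsum).eventually
    (ge_mem_nhds (pos_iff_ne_zero.2 hε))).exists
  refine ⟨K, le_trans ?_ hK⟩
  have : ((K : Set S)ᶜ) = ⋃ s : {s // s ∉ K}, {s.1} := by
    ext s
    simp
  rw [this]
  exact measure_iUnion_le _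

lemma exists_measure_singleton_ne_zero {S : Type*} [MeasurableSpace S] [Countable S]
    (μ : Measure S) [NeZero μ] : ∃ s, μ {s} ≠ 0 := by
  by_contra! H
  exact NeZero.ne μ (Measure.ext_of_singleton fun a => by simp [H a])

variable {E G : Type*} [MeasurableSpace E] [Countable E] [DiscreteMeasurableSpace E]
  [MeasurableSpace G] {f : E × G → E} {β : Measure G} {π : Measure E}

/-- Both coordinates of the coupled chain are dominated by the invariant measure. -/
lemma coupled_pow_compl_prod_le [IsFiniteMeasure π] (hf : Measurable f)
    (hπ : Kernel.Invariant (recursionKernel f β) π) {z : E × E} (h₁ : π {z.1} ≠ 0)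
    (h₂ : π {z.2} ≠ 0) (n : ℕ) (K : Set E) :
    (recursionKernel (coupledMap f) β ^ n) z (K ×ˢ K)ᶜ
      ≤ ((π {z.1})⁻¹ + (π {z.2})⁻¹) * π Kᶜ := by
  have hset : (K ×ˢ K)ᶜ = (Prod.fst ⁻¹' Kᶜ : Set (E × E)) ∪ Prod.snd ⁻¹' Kᶜ := by
    ext w
    simp only [Set.mem_compl_iff, Set.mem_prod, Set.mem_union, Set.mem_preimage]
    tauto
  rw [hset, add_mul]
  refine (measure_union_le _ _).trans (add_le_add ?_ ?_)
  · rw [coupled_pow_fst hf, ← ENNReal.mul_le_iff_le_inv h₁ (measure_ne_top _ _)]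
    exact measure_singleton_mul_pow_le hπ _ _ .of_discrete
  · rw [coupled_pow_snd hf, ← ENNReal.mul_le_iff_le_inv h₂ (measure_ne_top _ _)]
    exact measure_singleton_mul_pow_le hπ _ _ .of_discrete

lemma exists_finset_coupled_pow_compl_le [IsFiniteMeasure π] (hf : Measurable f)
    (hπ : Kernel.Invariant (recursionKernel f β) π) {z : E × E} (h₁ : π {z.1} ≠ 0)
    (h₂ : π {z.2} ≠ 0) {ε : ℝ≥0∞} (hε : ε ≠ 0) :
    ∃ K : Finset (E × E), ∀ n, (recursionKernel (coupledMap f) β ^ n) z (K : Set (E × E))ᶜ ≤ ε := by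
  have hC : (π {z.1})⁻¹ + (π {z.2})⁻¹ ≠ ∞ := by simp [h₁, h₂]
  obtain ⟨K, hK⟩ := exists_finset_measure_compl_le π (ENNReal.div_ne_zero.2 ⟨hε, hC⟩)
  refine ⟨K ×ˢ K, fun n => ?_⟩
  rw [Finset.coe_product]
  refine (coupled_pow_compl_prod_le hf hπ h₁ h₂ n K).trans ?_
  rw [mul_comm]
  exact ENNReal.mul_le_of_le_div hK

end Tightness

/-! ### Consequences of accordability for the coupled kernel -/

section Accordable

variable {E G : Type*} [MeasurableSpace E] [Countable E] [DiscreteMeasurableSpace E]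
  [MeasurableSpace G] {f : E × G → E} {β : Measure G} [IsProbabilityMeasure β]

/-- If all pairs of states are accordable, every invariant measure of the coupled kernel is carried
by the diagonal. -/
lemma measure_compl_diagonal_of_accordable (hf : Measurable f)
    (h : ∀ x y, Accordable f β x y) {μ : Measure (E × E)} [IsFiniteMeasure μ]
    (hμ : Kernel.Invariant (recursionKernel (coupledMap f) β) μ) :
    μ (Set.diagonal E)ᶜ = 0 := by
  by_contra hne
  have : NeZero (μ.restrict (Set.diagonal E)ᶜ) := ⟨fun h => hne (by
    simpa using congrArg (fun ν => ν Set.univ) h)⟩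
  obtain ⟨z, hz⟩ := exists_measure_singleton_ne_zero (μ.restrict (Set.diagonal E)ᶜ)
  rw [Measure.restrict_apply .of_discrete] at hz
  have hzD : z ∉ Set.diagonal E := fun hzD => hz (by
    rw [Set.singleton_inter_eq_empty.2 (by simpa using hzD), measure_empty])
  rw [Set.inter_eq_left.2 (by simpa using hzD)] at hz
  obtain ⟨l, -, hl⟩ := h z.1 z.2
  set κ := recursionKernel (coupledMap f) β
  -- By invariance, the mass of the diagonal after `l` steps is unchanged, yet it contains the mass
  -- already there and the part coming from `z`.
  have key : μ (Set.diagonal E) + (κ ^ l) z (Set.diagonal E) * μ {z} ≤ μ (Set.diagonal E) := by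
    conv_rhs => rw [← invariant_pow hμ l, Measure.bind_apply .of_discrete (Kernel.aemeasurable _)]
    rw [← lintegral_singleton (fun w => (κ ^ l) w (Set.diagonal E)),
      ← lintegral_indicator_one .of_discrete, ← lintegral_indicator .of_discrete,
      ← lintegral_add_left .of_discrete]
    refine lintegral_mono fun w => ?_
    by_cases hw : w ∈ Set.diagonal E
    · have : w ∉ ({z} : Set (E × E)) := fun H => hzD (by rwa [← Set.mem_singleton_iff.1 H])
      simp only [Set.indicator_of_mem hw, Set.indicator_of_notMem this, add_zero]
      exact (coupled_pow_diagonal hf l hw).ge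
    · simp only [Set.indicator_of_notMem hw, zero_add]
      exact Set.indicator_le_self _ _ _
  have h0 : (κ ^ l) z (Set.diagonal E) * μ {z} = 0 := by
    have : μ (Set.diagonal E) + (κ ^ l) z (Set.diagonal E) * μ {z} ≤ μ (Set.diagonal E) + 0 := by
      simpa using key
    simpa using (ENNReal.add_le_add_iff_left (measure_ne_top _ _)).1 this
  rcases mul_eq_zero.1 h0 with h0 | h0
  · exact hl.ne' h0
  · exact hz h0

/-- Since merging probabilities increase in time, the largest of finitely many times serves all
pairs of `K`. -/
lemma exists_uniform_accordable (hf : Measurable f) (h : ∀ x y, Accordable f β x y)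
    (K : Finset (E × E)) : ∃ (l : ℕ) (δ : ℝ≥0∞), δ ≠ 0 ∧
      ∀ w ∈ K, δ ≤ (recursionKernel (coupledMap f) β ^ l) w (Set.diagonal E) := by
  choose l hl1 hl using h
  refine ⟨K.sup fun w => l w.1 w.2,
    K.inf fun w => (recursionKernel (coupledMap f) β ^ l w.1 w.2) w (Set.diagonal E), ?_, ?_⟩
  · rw [← pos_iff_ne_zero, Finset.lt_inf_iff (by simp)]
    exact fun w _ => hl w.1 w.2
  · intro w hw
    refine (Finset.inf_le hw).trans (coupled_pow_diagonal_mono hf w ?_)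
    exact Finset.le_sup (f := fun w : E × E => l w.1 w.2) hw

/-- If all pairs of states are accordable, two copies started from states charged by an invariant
probability measure merge with probability one. -/
lemma tendsto_coupled_pow_compl_diagonal (hf : Measurable f) (h : ∀ x y, Accordable f β x y)
    {π : Measure E} [IsFiniteMeasure π] (hπ : Kernel.Invariant (recursionKernel f β) π)
    {z : E × E} (h₁ : π {z.1} ≠ 0) (h₂ : π {z.2} ≠ 0) :
    Tendsto (fun n => (recursionKernel (coupledMap f) β ^ n) z (Set.diagonal E)ᶜ) atTop (𝓝 0) := by
  have := isMarkovKernel_recursionKernel (β := β) (measurable_coupledMap hf)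
  have hM := fun n => isMarkovKernel_pow (κ := recursionKernel (coupledMap f) β) n
  set κ := recursionKernel (coupledMap f) β
  have hcompl : ∀ n w, (κ ^ n) w (Set.diagonal E)ᶜ = 1 - (κ ^ n) w (Set.diagonal E) :=
    fun n w => prob_compl_eq_one_sub .of_discrete
  have hanti : Antitone fun n => (κ ^ n) z (Set.diagonal E)ᶜ := fun n m hnm => by
    simp only [hcompl]
    exact tsub_le_tsub_left (coupled_pow_diagonal_mono hf z hnm) _
  have hlim := tendsto_atTop_iInf hanti
  set b := ⨅ n, (κ ^ n) z (Set.diagonal E)ᶜ with hb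
  have hbtop : b ≠ ∞ := ne_top_of_le_ne_top ENNReal.one_ne_top ((iInf_le _ 0).trans prob_le_one)
  suffices b = 0 by rwa [this] at hlim
  by_contra hb0
  -- If the limit `b` of the unmerged mass were positive, at least about `b / 2` of it would always
  -- lie in one finite set `K`, where a fixed proportion `δ` merges within `l` steps.
  obtain ⟨K, hK⟩ : ∃ K : Finset (E × E), ∀ n, (κ ^ n) z (K : Set (E × E))ᶜ ≤ b / 2 :=
    exists_finset_coupled_pow_compl_le hf hπ h₁ h₂ (ENNReal.half_pos hb0).ne'
  obtain ⟨l, δ, hδ0, hδ⟩ := exists_uniform_accordable hf h K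
  wlog hδtop : δ ≤ 1 generalizing δ
  · exact this (min δ 1) (by simp [hδ0]) (fun w hw => (min_le_left _ _).trans (hδ w hw))
      (min_le_right _ _)
  -- Pointwise inequality integrated against the law at time `n`: off the diagonal, at least `δ`
  -- merges from `K`, and points outside `K` are paid for by the last term. In the limit, `δ * b ≤ δ
  -- * (b / 2)`.
  have hstep : ∀ n, (κ ^ (n + l)) z (Set.diagonal E)ᶜ + δ * (κ ^ n) z (Set.diagonal E)ᶜ
      ≤ (κ ^ n) z (Set.diagonal E)ᶜ + δ * (b / 2) := by
    intro n
    refine le_trans ?_ (add_le_add_right (mul_le_mul_right (hK n) δ) _)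
    rw [Kernel.pow_add_apply_eq_lintegral _ _ _ _ .of_discrete]
    simp only [← lintegral_indicator_one (μ := (κ ^ n) z) (MeasurableSet.of_discrete (s := _))]
    rw [← lintegral_const_mul _ .of_discrete, ← lintegral_const_mul _ .of_discrete,
      ← lintegral_add_left .of_discrete, ← lintegral_add_left .of_discrete]
    refine lintegral_mono fun w => ?_
    by_cases hw : w ∈ Set.diagonal E
    · simp [hcompl, coupled_pow_diagonal hf l hw, hw, κ]
    · by_cases hwK : w ∈ K
      · simp only [hcompl, Set.indicator_of_mem (Set.mem_compl hw), Pi.one_apply, mul_one]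
        calc 1 - (κ ^ l) w (Set.diagonal E) + δ ≤ 1 - δ + δ := by
              gcongr
              exact hδ w hwK
          _ = 1 := tsub_add_cancel_of_le hδtop
          _ ≤ _ := le_self_add
      · simp only [Set.indicator_of_mem (Set.mem_compl hw), Pi.one_apply, mul_one,
          Set.indicator_of_mem (Set.mem_compl (Finset.mem_coe.not.2 hwK))]
        gcongr
        exact prob_le_one
  have hδ' : δ ≠ ∞ := ne_top_of_le_ne_top ENNReal.one_ne_top hδtop
  have hle : b + δ * b ≤ b + δ * (b / 2) :=
    le_of_tendsto_of_tendsto' (((tendsto_add_atTop_iff_nat l).2 hlim).add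
      (ENNReal.Tendsto.const_mul hlim (Or.inr hδ'))) (hlim.add tendsto_const_nhds) hstep
  have hle' := (ENNReal.mul_le_mul_iff_right hδ0 hδ').1 ((ENNReal.add_le_add_iff_left hbtop).1 hle)
  exact absurd hle' (not_le.2 (ENNReal.half_lt_self hb0 hbtop))

end Accordable

/-! ### From accordability to conditions 2 and 3 -/

section Markov

variable {Ω S : Type*} [MeasurableSpace Ω] [MeasurableSpace S] {P : Measure Ω} {κ : Kernel S S}
  {Z : ℤ → Ω → S}

lemma IsMarkovChain.map_succ (h : IsMarkovChain P κ Z) (n : ℤ) :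
    P.map (Z (n + 1)) = (P.map (Z n)).bind κ := by
  ext s hs
  have := h.condLaw n Set.univ s MeasurableSet.univ hs
  rw [Set.univ_inter, Measure.restrict_univ] at this
  rw [Measure.map_apply (h.measurable _) hs, this,
    Measure.bind_apply hs (Kernel.aemeasurable _),
    lintegral_map (Kernel.measurable_coe _ hs) (h.measurable _)]

lemma IsMarkovChain.invariant (h : IsMarkovChain P κ Z) (hZ : IsStationary P Z) (n : ℤ) :
    Kernel.Invariant κ (P.map (Z n)) := by
  change (P.map (Z n)).bind κ = P.map (Z n)
  rw [← h.map_succ n, hZ.map_eq h.measurable, ← hZ.map_eq h.measurable n]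

end Markov

section CompletedPast

variable {Ω S : Type*} [MeasurableSpace Ω] [MeasurableSpace S] {P : Measure Ω}

lemma completedPast_mono (Z : ℤ → Ω → S) : Monotone (completedPast P Z) := by
  rintro m n hmn s ⟨t, ht, hst⟩
  exact ⟨t, past_mono hmn _ ht, hst⟩

/-- Comparison of completed pasts reduces to the events `X k = e`. -/
lemma completedPast_le_completedPast {E : Type*} [MeasurableSpace E] [Countable E]
    {X : ℤ → Ω → E} {V : ℤ → Ω → S}
    (h : ∀ k e, MeasurableSet[completedPast P V k] (X k ⁻¹' {e})) (n : ℤ) :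
    completedPast P X n ≤ completedPast P V n := by
  have hle : past X n ≤ completedPast P V n := by
    refine iSup₂_le fun k hk => ?_
    rintro _ ⟨B, -, rfl⟩
    rw [← Set.biUnion_of_singleton B, Set.preimage_iUnion₂]
    exact MeasurableSet.biUnion (m := completedPast P V n) B.to_countable
      fun e _ => completedPast_mono V hk _ (h k e)
  rintro s ⟨t, ht, hst⟩
  obtain ⟨t', ht', htt'⟩ := hle _ ht
  exact ⟨t', ht', hst.trans htt'⟩

end CompletedPast

section Merging

variable {E G : Type*} [MeasurableSpace E] [Countable E] [DiscreteMeasurableSpace E]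
  [MeasurableSpace G] {f : E × G → E} {β : Measure G} [IsProbabilityMeasure β]

theorem ae_mem_diagonal_of_accordable (hf : Measurable f) (h : ∀ x y, Accordable f β x y)
    {Ω : Type*} [MeasurableSpace Ω] {P : Measure Ω} [IsProbabilityMeasure P] {Z : ℤ → Ω → E × E}
    (hZ : IsMarkovChain P (recursionKernel (coupledMap f) β) Z) (hstat : IsStationary P Z) :
    ∀ᵐ ω ∂P, ∀ n : ℤ, Z n ω ∈ Set.diagonal E := by
  refine ae_all_iff.2 fun n => ?_
  have := Measure.isProbabilityMeasure_map (μ := P) (hZ.measurable n).aemeasurable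
  have := measure_compl_diagonal_of_accordable hf h (hZ.invariant hstat n)
  rwa [Measure.map_apply (hZ.measurable n) .of_discrete] at this

lemma tendsto_bind_coupled_pow_compl_diagonal (hf : Measurable f) (h : ∀ x y, Accordable f β x y)
    {π : Measure E} [IsFiniteMeasure π] (hπ : Kernel.Invariant (recursionKernel f β) π)
    {z : E} (hz : π {z} ≠ 0) :
    Tendsto (fun n : ℕ => (π.map fun x => (x, z)).bind (recursionKernel (coupledMap f) β ^ n)
      (Set.diagonal E)ᶜ) atTop (𝓝 0) := by
  have := isMarkovKernel_recursionKernel (β := β) (measurable_coupledMap hf)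
  have hM := fun n => isMarkovKernel_pow (κ := recursionKernel (coupledMap f) β) n
  have heq : ∀ n : ℕ, (π.map fun x => (x, z)).bind (recursionKernel (coupledMap f) β ^ n)
      (Set.diagonal E)ᶜ
        = ∫⁻ x, (recursionKernel (coupledMap f) β ^ n) (x, z) (Set.diagonal E)ᶜ ∂π := fun n => by
    rw [Measure.bind_apply .of_discrete (Kernel.aemeasurable _), lintegral_map .of_discrete
      .of_discrete]
  simp only [heq]
  -- Pointwise merging is known only from charged states; countability makes these almost all
  -- states.
  have hcharged : ∀ᵐ x ∂π, π {x} ≠ 0 := by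
    change π {x | π {x} ≠ 0}ᶜ = 0
    refine (measure_null_iff_singleton (Set.to_countable _)).2 fun x hx => ?_
    simpa using hx
  rw [← lintegral_zero (μ := π)]
  refine tendsto_lintegral_of_dominated_convergence (fun _ => 1) (fun n => .of_discrete)
    (fun n => ae_of_all _ fun x => prob_le_one) (by simp) ?_
  filter_upwards [hcharged] with x hx
  exact tendsto_coupled_pow_compl_diagonal hf h hπ hx hz

theorem completedPast_le_of_accordable (hf : Measurable f) (h : ∀ x y, Accordable f β x y)
    {Ω : Type*} [MeasurableSpace Ω] {P : Measure Ω} [IsProbabilityMeasure P]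
    {X : ℤ → Ω → E} {V : ℤ → Ω → G} (hX : IsGoverned P f β X V) (hstat : IsStationary P X) (n : ℤ) :
    completedPast P X n ≤ completedPast P V n := by
  refine completedPast_le_completedPast (fun k e => ?_) n
  have hMarkov := hX.isMarkovChain hf
  have hprob := Measure.isProbabilityMeasure_map (μ := P) (hX.measurable_chain k).aemeasurable
  obtain ⟨z, hz⟩ := exists_measure_singleton_ne_zero (P.map (X k))
  have hlim := tendsto_bind_coupled_pow_compl_diagonal hf h (hMarkov.invariant hstat k) hz
  -- The copy started from `z` at time `k - m`, seen at time `k`; it uses only the innovations at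
  -- times `k - m + 1, …, k`.
  set Y : ℕ → Ω → E := fun m ω => orbit f (fun i => V (k - m + i + 1) ω) z m with hY
  have hbad : ∀ m, P {ω | X k ω ≠ Y m ω} = ((P.map (X k)).map fun x => (x, z)).bind
      (recursionKernel (coupledMap f) β ^ m) (Set.diagonal E)ᶜ := by
    intro m
    have hstart : P.map (fun ω => (X (k - m) ω, z)) = (P.map (X k)).map fun x => (x, z) := by
      rw [hstat.map_eq hX.measurable_chain k, ← hstat.map_eq hX.measurable_chain (k - m),
        Measure.map_map .of_discrete (hX.measurable_chain _)]
      rfl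
    have hmeas : Measurable[past (fun k ω => (X k ω, V k ω)) (k - m)]
        (fun ω => (X (k - m) ω, z)) :=
      (Measurable.of_discrete (f := fun x => (x, z))).comp (measurable_chain_past le_rfl)
    have hlaw := hX.map_orbit (measurable_coupledMap hf) hmeas m
    rw [← hstart, ← hlaw, Measure.map_apply _ .of_discrete]
    · refine measure_congr ?_
      filter_upwards [hX.ae_eq_orbit (k - m) m] with ω hω
      rw [sub_add_cancel] at hω
      apply propext
      change X k ω ≠ Y m ω ↔ orbit (coupledMap f) _ _ m ∈ (Set.diagonal E)ᶜ
      rw [orbit_coupledMap, Set.mem_compl_iff, Set.mem_diagonal_iff, hω]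
    · exact measurable_orbit (measurable_coupledMap hf) (hmeas.mono (hX.past_pair_le _) le_rfl) m
        fun i _ => hX.measurable_innovation _
  -- A subsequence with summable errors, so that Borel–Cantelli turns convergence in probability
  -- into eventual equality.
  have hsub : ∀ j : ℕ, ∃ m, P {ω | X k ω ≠ Y m ω} ≤ 2⁻¹ ^ j := fun j => by
    simp only [hbad]
    exact (hlim.eventually (ge_mem_nhds (by simp [ENNReal.pow_pos]))).exists
  choose φ hφ using hsub
  have hsum : ∑' j, P {ω | X k ω ≠ Y (φ j) ω} ≠ ∞ := by
    refine ne_top_of_le_ne_top ?_ (ENNReal.tsum_le_tsum hφ)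
    rw [ENNReal.tsum_geometric]
    simp
  -- The event that `Y (φ j) = e` for all large `j`, measurable with respect to the innovations up
  -- to time `k`.
  refine ⟨⋃ i : ℕ, ⋂ j : ℕ, ⋂ _ : i ≤ j, Y (φ j) ⁻¹' {e}, ?_, ?_⟩
  · refine MeasurableSet.iUnion fun i => MeasurableSet.iInter fun j =>
      MeasurableSet.iInter fun _ => ?_
    exact measurable_orbit (m := past V k) hf measurable_const _
      (fun i hi => measurable_past (by lia)) (measurableSet_singleton e)
  · filter_upwards [ae_eventually_notMem hsum] with ω hω
    obtain ⟨i₀, hi₀⟩ := eventually_atTop.1 hω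
    apply propext
    change X k ω = e ↔ ω ∈ ⋃ i : ℕ, ⋂ j : ℕ, ⋂ _ : i ≤ j, Y (φ j) ⁻¹' {e}
    simp only [Set.mem_iUnion, Set.mem_iInter, Set.mem_preimage, Set.mem_singleton_iff]
    have heq : ∀ j ≥ i₀, X k ω = Y (φ j) ω := fun j hj => by simpa using hi₀ j hj
    constructor
    · rintro rfl
      exact ⟨i₀, fun j hj => (heq j hj).symm⟩
    · rintro ⟨i, hi⟩
      rw [heq (max i i₀) (le_max_right _ _), hi _ (le_max_left _ _)]

end Merging

/-! ### Random sequences driven by a kernel -/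

section StochasticRecursion

lemma map_compProd_comap {A B C : Type*} [MeasurableSpace A] [MeasurableSpace B] [MeasurableSpace C]
    (ν : Measure A) [SFinite ν] (κ : Kernel B C) [IsSFiniteKernel κ] {e : A → B}
    (he : Measurable e) :
    (ν ⊗ₘ κ.comap e he).map (Prod.map e id) = ν.map e ⊗ₘ κ := by
  ext s hs
  rw [Measure.map_apply (by fun_prop) hs, Measure.compProd_apply hs,
    Measure.compProd_apply ((he.prodMap measurable_id) hs),
    lintegral_map (Kernel.measurable_kernel_prodMk_left hs) he]
  rfl

/-- The states reached by the updates `u` from the initial state `(x 0).1` with the innovations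
`(x i).2`, as a function of the path up to time `n`. -/
def pathState {A B : Type*} (u : A × B → A) : (n : ℕ) → ((i : Finset.Iic n) → A × B) → A
  | 0, x => (x ⟨0, by simp⟩).1
  | n + 1, x =>
    u (pathState u n (Preorder.frestrictLe₂ (π := fun _ : ℕ => A × B) (Nat.le_succ n) x),
      (x ⟨n + 1, by simp⟩).2)

lemma measurable_pathState {A B : Type*} [MeasurableSpace A] [MeasurableSpace B] {u : A × B → A}
    (hu : Measurable u) (n : ℕ) : Measurable (pathState u n) := by
  induction n with
  | zero => exact measurable_fst.comp (measurable_pi_apply _)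
  | succ n ih =>
    exact hu.comp ((ih.comp (Preorder.measurable_frestrictLe₂ _)).prodMk
      (measurable_snd.comp (measurable_pi_apply _)))

/-- A random sequence `Y (n + 1) = u (Y n, b n)`, where `b n` is drawn from `Y n` with the
kernel `κ`. -/
theorem exists_stochastic_recursion {A : Type u} {B : Type v} [MeasurableSpace A]
    [MeasurableSpace B] (κ : Kernel A B) [IsMarkovKernel κ] {u : A × B → A} (hu : Measurable u)
    (M : Measure A) [IsProbabilityMeasure M] :
    ∃ (Ω : Type (max u v)) (_ : MeasurableSpace Ω) (P : Measure Ω) (_ : IsProbabilityMeasure P)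
      (Y : ℕ → Ω → A) (b : ℕ → Ω → B), (∀ n, Measurable (Y n)) ∧ (∀ n, Measurable (b n)) ∧
        P.map (Y 0) = M ∧ (∀ n ω, Y (n + 1) ω = u (Y n ω, b n ω)) ∧
        ∀ n, P.map (fun ω => (Y n ω, b n ω)) = P.map (Y n) ⊗ₘ κ := by
  have : Nonempty A := nonempty_of_isProbabilityMeasure M
  have : Nonempty B := by
    have := nonempty_of_isProbabilityMeasure (κ (Classical.arbitrary A))
    exact this
  have a₀ : A := Classical.arbitrary A
  have b₀ : B := Classical.arbitrary B
  -- Only the second coordinate carries the draw: the state is recomputed from the path by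
  -- `pathState`, so `a₀`, and `b₀` below, are placeholders.
  let κ' : (n : ℕ) → Kernel ((i : Finset.Iic n) → A × B) (A × B) := fun n =>
    (κ.comap (pathState u n) (measurable_pathState hu n)).map (fun b => (a₀, b))
  have hκ' : ∀ n, IsMarkovKernel (κ' n) := fun n => Kernel.IsMarkovKernel.map _ (by fun_prop)
  let μ₀ : Measure (A × B) := M.map (fun a => (a, b₀))
  have hμ₀ : IsProbabilityMeasure μ₀ := Measure.isProbabilityMeasure_map (by fun_prop)
  let P := Kernel.trajMeasure (X := fun _ : ℕ => A × B) μ₀ κ'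
  refine ⟨ℕ → A × B, inferInstance, P, inferInstance,
    fun n ω => pathState u n (Preorder.frestrictLe n ω), fun n ω => (ω (n + 1)).2, fun n => ?_,
    fun n => by fun_prop, ?_, fun n ω => rfl, fun n => ?_⟩
  · exact (measurable_pathState hu n).comp (Preorder.measurable_frestrictLe _)
  · have h₀ : P.map (Preorder.frestrictLe 0)
        = μ₀.map (MeasurableEquiv.piUnique (fun _ : Finset.Iic 0 => A × B)).symm := by
      change Measure.map _ (Measure.bind _ _) = _
      rw [Measure.map_comp _ _ (by fun_prop), Kernel.traj_map_frestrictLe, Kernel.partialTraj_self,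
        Measure.id_comp]
    have h₁ : P.map (fun ω => pathState u 0 (Preorder.frestrictLe 0 ω))
        = (P.map (Preorder.frestrictLe 0)).map (pathState u 0) :=
      (Measure.map_map (measurable_pathState hu 0) (Preorder.measurable_frestrictLe _)).symm
    rw [h₁, h₀, Measure.map_map (measurable_pathState hu 0) (MeasurableEquiv.measurable _),
      Measure.map_map ((measurable_pathState hu 0).comp (MeasurableEquiv.measurable _))
        (by fun_prop)]
    exact Measure.map_id
  · have h := Kernel.map_frestrictLe_trajMeasure_compProd_eq_map_trajMeasure
      (X := fun _ : ℕ => A × B) (μ₀ := μ₀) (κ := κ') (a := n)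
    rw [Measure.compProd_map (by fun_prop)] at h
    have h₁ : P.map (fun ω => pathState u n (Preorder.frestrictLe n ω))
        = (P.map (Preorder.frestrictLe n)).map (pathState u n) :=
      (Measure.map_map (measurable_pathState hu n) (Preorder.measurable_frestrictLe _)).symm
    have h₂ := congrArg (fun ν => ν.map (Prod.map (pathState u n) Prod.snd)) h
    have hm : Measurable (Prod.map (pathState u n) (Prod.snd : A × B → B)) :=
      (measurable_pathState hu n).prodMap measurable_snd
    rw [Measure.map_map hm (by fun_prop), Measure.map_map hm (by fun_prop)] at h₂
    rw [h₁, ← map_compProd_comap _ κ (measurable_pathState hu n)]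
    exact h₂.symm

end StochasticRecursion

/-! ### Time reversal and the natural extension -/

section Backward

variable {S G : Type*} [MeasurableSpace S] [Countable S] [MeasurableSingletonClass S]
  [MeasurableSpace G]

open Classical in
/-- The conditional law of `(X_n, V_{n+1})` given `X_{n+1} = s`, when `X_n` has law `μ`. -/
noncomputable def backwardKernel (g : S × G → S) (μ : Measure S) (β : Measure G) :
    Kernel S (S × G) where
  -- The value on a null fibre is chosen only to get a probability; under invariance such states are
  -- `μ`-null.
  toFun s := if (μ.prod β) (g ⁻¹' {s}) = 0 then μ.prod β else (μ.prod β)[|g ⁻¹' {s}]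
  measurable' := measurable_of_countable _

variable {g : S × G → S} {μ : Measure S} [IsProbabilityMeasure μ]
  {β : Measure G} [IsProbabilityMeasure β]

instance : IsMarkovKernel (backwardKernel g μ β) := ⟨fun s => by
  by_cases h : (μ.prod β) (g ⁻¹' {s}) = 0
  · simp only [backwardKernel, Kernel.coe_mk, h, if_true]
    infer_instance
  · simp only [backwardKernel, Kernel.coe_mk, h, if_false]
    exact cond_isProbabilityMeasure h⟩

/-- Disintegration of `μ ⊗ β` along `g`, by cutting into the countably many fibres; invariance says
that the fibre over `s` has mass `μ {s}`. -/
lemma compProd_backwardKernel (hg : Measurable g) (hμ : (μ.prod β).map g = μ) :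
    μ ⊗ₘ backwardKernel g μ β = (μ.prod β).map (fun q => (g q, q)) := by
  ext t ht
  have hunion : (fun q => (g q, q)) ⁻¹' t = ⋃ s, (g ⁻¹' {s} ∩ Prod.mk s ⁻¹' t) := by
    ext q
    simp
  rw [Measure.compProd_apply ht, Measure.map_apply (by fun_prop) ht, lintegral_countable', hunion,
    measure_iUnion]
  · refine tsum_congr fun s => ?_
    have hs : μ {s} = (μ.prod β) (g ⁻¹' {s}) := by
      conv_lhs => rw [← hμ, Measure.map_apply hg (measurableSet_singleton _)]
    by_cases h : (μ.prod β) (g ⁻¹' {s}) = 0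
    · rw [hs, h, mul_zero, measure_mono_null Set.inter_subset_left h]
    · simp only [backwardKernel, Kernel.coe_mk, h, if_false]
      rw [hs, cond_mul_eq_inter (hg (measurableSet_singleton _))]
  · intro s s' hss'
    refine Set.disjoint_left.2 fun q hq hq' => hss' ?_
    rw [← hq.1, ← hq'.1]
  · exact fun s => (hg (measurableSet_singleton s)).inter (measurable_prodMk_left ht)

end Backward

section Shift

variable {S G : Type*}

/-- The sequence `v, φ 0, φ 1, …`. -/
def consSeq (q : G × (ℕ → G)) : ℕ → G
  | 0 => q.1
  | n + 1 => q.2 n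

@[fun_prop]
lemma measurable_consSeq [MeasurableSpace G] : Measurable (consSeq : G × (ℕ → G) → ℕ → G) := by
  refine measurable_pi_lambda _ fun n => ?_
  cases n with
  | zero => exact measurable_fst
  | succ n => exact (measurable_pi_apply n).comp measurable_snd

lemma map_consSeq [MeasurableSpace G] (β : Measure G) [IsProbabilityMeasure β] :
    (β.prod (Measure.infinitePi fun _ : ℕ => β)).map consSeq
      = Measure.infinitePi fun _ : ℕ => β := by
  classical
  refine Measure.eq_infinitePi _ fun I t ht => ?_
  obtain ⟨N, hN⟩ : ∃ N, I ⊆ Finset.range (N + 1) :=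
    ⟨I.sup id, fun i hi => by
      have := Finset.le_sup (f := id) hi
      simp only [id] at this
      rw [Finset.mem_range]
      lia⟩
  -- Padding by `Set.univ` reduces to boxes over an initial segment of times, where the head splits
  -- off.
  let box : ℕ → Set G := fun i => if i ∈ I then t i else Set.univ
  have ht' : ∀ i, MeasurableSet (box i) := fun i => by
    by_cases h : i ∈ I <;> simp [box, h, ht i]
  have hpre : consSeq ⁻¹' (Set.pi I t)
      = box 0 ×ˢ Set.pi (Finset.range N) (fun i => box (i + 1)) := by
    ext q
    simp only [Set.mem_preimage, Set.mem_pi, Finset.mem_coe, Set.mem_prod, Finset.mem_range, box]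
    constructor
    · intro H
      refine ⟨?_, fun i _ => ?_⟩
      · split_ifs with h
        · exact H 0 h
        · trivial
      · split_ifs with h
        · exact H (i + 1) h
        · trivial
    · rintro ⟨H₀, H⟩ i hi
      cases i with
      | zero => simpa [hi, consSeq] using H₀
      | succ i => simpa [hi, consSeq] using H i (by simpa using hN hi)
  rw [Measure.map_apply measurable_consSeq (.pi I.countable_toSet fun i _ => ht i), hpre,
    Measure.prod_prod, Measure.infinitePi_pi _ (fun i _ => ht' _), mul_comm,
    ← Finset.prod_range_succ' (fun i => β (box i)), ← Finset.prod_subset hN]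
  · exact Finset.prod_congr rfl fun i hi => by simp [box, hi]
  · intro i _ hi
    simp [box, hi]

/-- The state and the sequence of future innovations, one unit of time later. -/
def advance (g : S × G → S) (q : S × (ℕ → G)) : S × (ℕ → G) :=
  (g (q.1, q.2 0), fun i => q.2 (i + 1))

lemma measurable_advance [MeasurableSpace S] [MeasurableSpace G] {g : S × G → S}
    (hg : Measurable g) : Measurable (advance g) := by
  unfold advance
  fun_prop

lemma iterate_advance (g : S × G → S) (q : S × (ℕ → G)) (n : ℕ) :
    (advance g)^[n] q = (orbit g q.2 q.1 n, fun i => q.2 (i + n)) := by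
  induction n with
  | zero => rfl
  | succ n ih =>
    rw [Function.iterate_succ_apply', ih]
    simp [advance, orbit, add_assoc, add_comm 1 n]

end Shift

section NaturalExtension

lemma _root_.ProbabilityTheory.IndepFun.comp_of_map {Ω Ω' A B : Type*} [MeasurableSpace Ω]
    [MeasurableSpace Ω'] [MeasurableSpace A] [MeasurableSpace B] {P : Measure Ω} {T : Ω → Ω'}
    {F : Ω' → A} {H : Ω' → B} (h : IndepFun F H (P.map T)) (hT : Measurable T) (hF : Measurable F)
    (hH : Measurable H) : IndepFun (F ∘ T) (H ∘ T) P := by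
  rw [indepFun_iff_measure_inter_preimage_eq_mul] at h ⊢
  intro s t hs ht
  have := h s t hs ht
  rwa [Measure.map_apply hT ((hF hs).inter (hH ht)), Measure.map_apply hT (hF hs),
    Measure.map_apply hT (hH ht)] at this

variable {S : Type u} {G : Type v} [MeasurableSpace S] [MeasurableSpace G] {g : S × G → S}
  {μ : Measure S} {β : Measure G} [IsProbabilityMeasure β]

/-- Prepend an innovation to the future and replace the current state. -/
def rewind (p : (S × (ℕ → G)) × (S × G)) : S × (ℕ → G) :=
  (p.2.1, consSeq (p.2.2, p.1.2))

lemma map_prod_consSeq [SFinite μ] :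
    ((μ.prod β).prod (Measure.infinitePi fun _ : ℕ => β)).map
        (fun p => (p.1.1, consSeq (p.1.2, p.2)))
      = μ.prod (Measure.infinitePi fun _ : ℕ => β) := by
  conv_rhs => rw [← map_consSeq β]
  have := Measure.map_prod_map μ (β.prod (Measure.infinitePi fun _ : ℕ => β)) measurable_id
    (measurable_consSeq (G := G))
  rw [Measure.map_id] at this
  rw [this, ← Measure.prodAssoc_prod, Measure.map_map (by fun_prop) (by fun_prop)]
  rfl

variable [IsProbabilityMeasure μ]

/-- The states and innovations listed are functions of the initial state and of the innovations
before index `n`, which are jointly independent of innovation `n`. -/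
lemma indep_innovation_orbit (hg : Measurable g) (n : ℕ) :
    Indep (MeasurableSpace.comap (fun q : S × (ℕ → G) => q.2 n) inferInstance)
      (MeasurableSpace.comap (fun (q : S × (ℕ → G)) (i : Fin n) =>
        (orbit g q.2 q.1 (i + 1), q.2 i)) inferInstance)
      (μ.prod (Measure.infinitePi fun _ : ℕ => β)) := by
  set M := μ.prod (Measure.infinitePi fun _ : ℕ => β) with hM
  set m : ℕ → MeasurableSpace (S × (ℕ → G)) := fun i =>
    MeasurableSpace.comap (fun q : S × (ℕ → G) => q.2 i) inferInstance
  have hm : ∀ i, m i ≤ (inferInstance : MeasurableSpace (S × (ℕ → G))) := fun i =>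
    Measurable.comap_le (by fun_prop)
  have hiI : iIndep m M := by
    change iIndepFun (fun (i : ℕ) (q : S × (ℕ → G)) => q.2 i) M
    rw [iIndepFun_iff_map_fun_eq_infinitePi_map (by fun_prop)]
    have hsnd : M.map Prod.snd = Measure.infinitePi fun _ : ℕ => β := by
      rw [hM, Measure.map_snd_prod]
      simp
    have hcoord : ∀ i, M.map (fun q => q.2 i) = β := fun i => by
      have := Measure.map_map (μ := M) (measurable_pi_apply i) measurable_snd
      rw [hsnd, Measure.infinitePi_map_eval] at this
      exact this.symm
    simp only [hcoord]
    exact hsnd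
  have hpast : Indep (m n) (⨆ i ∈ Set.Iio n, m i) M := by
    have := indep_iSup_of_disjoint hm hiI (S := {n}) (T := Set.Iio n) (by simp)
    simpa using this
  have hfst : Indep (m n ⊔ ⨆ i ∈ Set.Iio n, m i)
      (MeasurableSpace.comap (Prod.fst : S × (ℕ → G) → S) inferInstance) M := by
    have h : IndepFun (Prod.fst : S × (ℕ → G) → S) Prod.snd M :=
      indepFun_prod (X := id) (Y := id) measurable_id measurable_id
    have hle : ∀ i, m i ≤ MeasurableSpace.comap (Prod.snd : S × (ℕ → G) → ℕ → G) inferInstance := by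
      rintro i _ ⟨s, hs, rfl⟩
      exact ⟨_, (measurable_pi_apply i) hs, rfl⟩
    exact (indep_of_indep_of_le_right h (sup_le (hle n) (iSup₂_le fun i _ => hle i))).symm
  refine indep_of_indep_of_le_right (indep_sup_of_indep_sup (hm n) (iSup₂_le fun i _ => hm i)
    measurable_fst.comap_le hpast hfst) (measurable_iff_comap_le.1 ?_)
  set F := (⨆ i ∈ Set.Iio n, m i)
    ⊔ MeasurableSpace.comap (Prod.fst : S × (ℕ → G) → S) inferInstance
  have hcoord : ∀ i < n, Measurable[F] (fun q : S × (ℕ → G) => q.2 i) := fun i hi =>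
    measurable_iff_comap_le.2 ((le_iSup₂_of_le (f := fun i (_ : i ∈ Set.Iio n) => m i) i hi
      le_rfl).trans le_sup_left)
  have hF : Measurable[F] (Prod.fst : S × (ℕ → G) → S) := measurable_iff_comap_le.2 le_sup_right
  refine @measurable_pi_lambda _ _ _ F _ _ fun i => ?_
  exact (measurable_orbit (m := F) hg (V := fun i q => q.2 i) hF _
    fun j hj => hcoord j (by lia)).prodMk (hcoord i i.2)

variable [Countable S] [MeasurableSingletonClass S]

/-- The future innovations are independent of the current state and the backward draw ignores them,
so they can be frozen by Fubini. -/
lemma compProd_backwardKernel_future (hg : Measurable g) (hμ : (μ.prod β).map g = μ) :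
    μ.prod (Measure.infinitePi fun _ : ℕ => β)
        ⊗ₘ (backwardKernel g μ β).comap Prod.fst measurable_fst
      = ((μ.prod β).prod (Measure.infinitePi fun _ : ℕ => β)).map
        (fun p => ((g p.1, p.2), p.1)) := by
  ext t ht
  have hmeas : Measurable fun p : (S × G) × (ℕ → G) => ((g p.1, p.2), p.1) := by fun_prop
  have hswap : ∀ φ : ℕ → G, Measurable fun p : S × (S × G) => ((p.1, φ), p.2) := by fun_prop
  rw [Measure.compProd_apply ht, Measure.map_apply hmeas ht, Measure.prod_apply_symm (hmeas ht),
    lintegral_prod_symm _ (Kernel.measurable_kernel_prodMk_left ht).aemeasurable]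
  refine lintegral_congr fun φ => ?_
  have h := congrArg (fun ν => ν ((fun p : S × (S × G) => ((p.1, φ), p.2)) ⁻¹' t))
    (compProd_backwardKernel hg hμ)
  simp only [Measure.compProd_apply (hswap φ ht)] at h
  rw [Measure.map_apply (by fun_prop) (hswap φ ht)] at h
  exact h

/-- The dynamics `advance g` has a natural extension: a stationary sequence indexed by `ℤ`. -/
theorem exists_naturalExtension (hg : Measurable g) (hμ : (μ.prod β).map g = μ) :
    ∃ (Ω : Type (max u v)) (_ : MeasurableSpace Ω) (P : Measure Ω) (_ : IsProbabilityMeasure P)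
      (T : ℤ → Ω → S × (ℕ → G)), (∀ k, Measurable (T k)) ∧
        (∀ k, P.map (T k) = μ.prod (Measure.infinitePi fun _ : ℕ => β)) ∧
        ∀ k, ∀ᵐ ω ∂P, T (k + 1) ω = advance g (T k ω) := by
  set M := μ.prod (Measure.infinitePi fun _ : ℕ => β) with hM
  have hrewind : Measurable (rewind : (S × (ℕ → G)) × (S × G) → S × (ℕ → G)) := by
    unfold rewind
    fun_prop
  obtain ⟨Ω, _, P, hP, Y, b, hY, hb, hY0, hrec, hlaw⟩ := exists_stochastic_recursion
    ((backwardKernel g μ β).comap Prod.fst measurable_fst) hrewind M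
  have hYM : ∀ n, P.map (Y n) = M := by
    intro n
    induction n with
    | zero => exact hY0
    | succ n ih =>
      have : Y (n + 1) = rewind ∘ fun ω => (Y n ω, b n ω) := funext fun ω => hrec n ω
      rw [this, ← Measure.map_map hrewind ((hY n).prodMk (hb n)), hlaw, ih,
        compProd_backwardKernel_future hg hμ, Measure.map_map hrewind (by fun_prop)]
      exact map_prod_consSeq
  -- The backward draw almost surely satisfies `g (b n) = (Y n).1`, so advancing undoes `rewind`.
  have hadv : ∀ n, ∀ᵐ ω ∂P, Y n ω = advance g (Y (n + 1) ω) := by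
    intro n
    have hset : MeasurableSet {p : (S × (ℕ → G)) × (S × G) | p.1.1 = g p.2} :=
      measurableSet_eq_fun (by fun_prop) (by fun_prop)
    have h : ∀ᵐ p ∂(P.map fun ω => (Y n ω, b n ω)), p.1.1 = g p.2 := by
      rw [hlaw, hYM, compProd_backwardKernel_future hg hμ, ae_map_iff (by fun_prop) hset]
      exact ae_of_all _ fun p => rfl
    rw [ae_map_iff ((hY n).prodMk (hb n)).aemeasurable hset] at h
    filter_upwards [h] with ω hω
    rw [hrec]
    exact Prod.ext hω rfl
  have hpres : M.map (advance g) = M := by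
    conv_lhs => rw [hM, ← map_prod_consSeq]
    rw [Measure.map_map (measurable_advance hg) (by fun_prop)]
    have : advance g ∘ (fun p : (S × G) × (ℕ → G) => (p.1.1, consSeq (p.1.2, p.2)))
        = Prod.map g id := rfl
    rw [this, ← Measure.map_prod_map _ _ hg measurable_id, hμ, Measure.map_id]
  -- Both truncations share one formula: `Y (-k)` for `k ≤ 0`, and the `k`-th forward iterate of `Y
  -- 0` for `k ≥ 0`.
  refine ⟨Ω, _, P, hP, fun k ω => (advance g)^[k.toNat] (Y (-k).toNat ω), fun k => ?_, fun k => ?_,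
    fun k => ?_⟩
  · exact ((measurable_advance hg).iterate _).comp (hY _)
  · have hiter : ∀ n : ℕ, M.map (advance g)^[n] = M := fun n =>
      ((⟨measurable_advance hg, hpres⟩ : MeasurePreserving (advance g) M M).iterate n).map_eq
    have := Measure.map_map (μ := P) ((measurable_advance hg).iterate k.toNat) (hY (-k).toNat)
    rw [hYM, hiter] at this
    exact this.symm
  · rcases le_or_gt 0 k with hk | hk
    · refine ae_of_all _ fun ω => ?_
      beta_reduce
      rw [show (k + 1).toNat = k.toNat + 1 by lia, show (-(k + 1)).toNat = (-k).toNat by lia,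
        Function.iterate_succ_apply']
    · filter_upwards [hadv (-(k + 1)).toNat] with ω hω
      rw [show (k + 1).toNat = 0 by lia, show k.toNat = 0 by lia,
        show (-k).toNat = (-(k + 1)).toNat + 1 by lia]
      exact hω

/-- Every invariant probability measure is the law of a stationary chain governed by `g`. -/
theorem exists_isGoverned (hg : Measurable g)
    (hμ : Kernel.Invariant (recursionKernel g β) μ) :
    ∃ (Ω : Type (max u v)) (_ : MeasurableSpace Ω) (P : Measure Ω) (_ : IsProbabilityMeasure P)
      (X : ℤ → Ω → S) (V : ℤ → Ω → G), IsGoverned P g β X V ∧ IsStationary P X ∧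
        ∀ n, P.map (X n) = μ := by
  have hμ' : (μ.prod β).map g = μ := by rw [← bind_recursionKernel hg, hμ.def]
  obtain ⟨Ω, _, P, hP, T, hT, hlaw, hadv⟩ := exists_naturalExtension hg hμ'
  have hX : ∀ n, P.map (fun ω => (T n ω).1) = μ := fun n => by
    have := Measure.map_map (μ := P) measurable_fst (hT n)
    rw [hlaw, Measure.map_fst_prod, measure_univ, one_smul] at this
    exact this.symm
  have hiter : ∀ k (i : ℕ), ∀ᵐ ω ∂P,
      T (k + i) ω = (orbit g (T k ω).2 (T k ω).1 i, fun j => (T k ω).2 (j + i)) := by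
    intro k i
    simp only [← iterate_advance]
    induction i with
    | zero => simp
    | succ i ih =>
      filter_upwards [ih, hadv (k + i)] with ω h₁ h₂
      rw [Function.iterate_succ_apply', ← h₁, ← h₂]
      push_cast
      rw [add_assoc]
  set X : ℤ → Ω → S := fun n ω => (T n ω).1 with hXdef
  -- `T (n - 1)` stores the innovations still to come after time `n - 1`; the first of them produces
  -- `X n`.
  set V : ℤ → Ω → G := fun n ω => (T (n - 1) ω).2 0 with hVdef
  have hXm : ∀ n, Measurable (X n) := fun n => measurable_fst.comp (hT n)
  have hVm : ∀ n, Measurable (V n) := fun n =>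
    (measurable_pi_apply 0).comp (measurable_snd.comp (hT _))
  have hpast : ∀ n : ℤ, Indep (MeasurableSpace.comap (V (n + 1)) inferInstance)
      (past (fun k ω => (X k ω, V k ω)) n) P := by
    intro n
    -- The block of pairs at times `n - j + 1, …, n`. It is a function of `T (n - j)`, and these
    -- blocks increase to the whole past.
    let W : (j : ℕ) → Ω → Fin j → S × G := fun j ω i =>
      (X (n - j + i + 1) ω, V (n - j + i + 1) ω)
    have hW : ∀ j, Measurable (W j) := fun j =>
      measurable_pi_lambda _ fun i => (hXm _).prodMk (hVm _)
    have hle : past (fun k ω => (X k ω, V k ω)) n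
        ≤ ⨆ j, MeasurableSpace.comap (W j) inferInstance := by
      refine iSup₂_le fun k hk => le_iSup_of_le (n - k + 1).toNat ?_
      rw [← measurable_iff_comap_le]
      have : (fun ω => (X k ω, V k ω))
          = (fun w => w ⟨0, by lia⟩) ∘ W (n - k + 1).toNat := by
        funext ω
        simp only [W, Function.comp]
        rw [show n - ((n - k + 1).toNat : ℤ) + ((0 : ℕ) : ℤ) + 1 = k by lia]
      change Measurable[MeasurableSpace.comap (W (n - k + 1).toNat) inferInstance]
        fun ω => (X k ω, V k ω)
      rw [this]
      exact (measurable_pi_apply _).comp (comap_measurable _)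
    have hmono : Monotone fun j => MeasurableSpace.comap (W j) inferInstance := by
      intro j j' hjj'
      change MeasurableSpace.comap (W j) _ ≤ MeasurableSpace.comap (W j') _
      rw [← measurable_iff_comap_le]
      have : W j = (fun w (i : Fin j) => w ⟨i + (j' - j), by lia⟩) ∘ W j' := by
        funext ω i
        simp only [W, Function.comp]
        rw [show n - (j' : ℤ) + ((i + (j' - j) : ℕ) : ℤ) + 1 = n - j + i + 1 by lia]
      rw [this]
      exact (measurable_pi_lambda _ fun i => measurable_pi_apply _).comp (comap_measurable _)
    refine indep_of_indep_of_le_right (Indep.symm ?_) hle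
    refine indep_iSup_of_monotone (fun j => ?_) (fun j => (hW j).comap_le) (hVm _).comap_le hmono
    change IndepFun (W j) (V (n + 1)) P
    have hI := indep_innovation_orbit (μ := μ) (β := β) hg j
    rw [← hlaw (n - j)] at hI
    have hI' : IndepFun (fun q : S × (ℕ → G) => q.2 j)
      (fun (q : S × (ℕ → G)) (i : Fin j) => (orbit g q.2 q.1 (i + 1), q.2 i))
      (P.map (T (n - j))) := hI
    have hO : Measurable (fun (q : S × (ℕ → G)) (i : Fin j) =>
        (orbit g q.2 q.1 (i + 1), q.2 i)) := measurable_pi_lambda _ fun i =>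
      (measurable_orbit hg (V := fun i (q : S × (ℕ → G)) => q.2 i) measurable_fst _
        fun i _ => by fun_prop).prodMk (by fun_prop)
    refine (hI'.comp_of_map (hT _) (by fun_prop) hO).symm.congr ?_ ?_
    · have hall : ∀ᵐ ω ∂P, ∀ i : ℕ, T (n - j + i) ω
          = (orbit g (T (n - j) ω).2 (T (n - j) ω).1 i, fun l => (T (n - j) ω).2 (l + i)) :=
        ae_all_iff.2 fun i => hiter _ i
      filter_upwards [hall] with ω hω
      funext i
      have h₁ := hω (i + 1)
      push_cast at h₁
      simp only [W, hXdef, hVdef, Function.comp, add_sub_cancel_right, hω i]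
      rw [add_assoc (n - (j : ℤ)), h₁, zero_add]
    · filter_upwards [hiter (n - j) j] with ω hω
      rw [sub_add_cancel] at hω
      simp only [hVdef, Function.comp, add_sub_cancel_right, hω, zero_add]
  have hgov : IsGoverned P g β X V :=
    { measurable_chain := hXm
      measurable_innovation := hVm
      law_innovation := fun n => by
        have := Measure.map_map (μ := P) (g := fun q : S × (ℕ → G) => q.2 0)
          (by fun_prop) (hT (n - 1))
        have h' := Measure.map_map (μ := μ.prod (Measure.infinitePi fun _ : ℕ => β))
          (measurable_pi_apply 0) measurable_snd
        rw [Measure.map_snd_prod, measure_univ, one_smul, Measure.infinitePi_map_eval] at h'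
        rw [hlaw] at this
        exact this.symm.trans h'.symm
      iIndep_innovation := iIndepFun_of_indep_past fun n =>
        indep_of_indep_of_le_right (hpast n)
          (iSup₂_le fun k hk => (measurable_innovation_past hk).comap_le)
      indep_past := hpast
      recursion := fun n => by
        filter_upwards [hadv n] with ω hω
        simp only [hXdef, hVdef, add_sub_cancel_right, hω]
        rfl }
  exact ⟨Ω, _, P, hP, X, V, hgov, (hgov.isMarkovChain hg).isStationary hX, hX⟩

end NaturalExtension

/-! ### Invariant probabilities by Cesàro averaging -/

section Cesaro

variable {S : Type*} [MeasurableSpace S]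

/-- The mean of the first `N + 1` laws of the chain started at `z`. -/
noncomputable def cesaroLaw (κ : Kernel S S) (z : S) (N : ℕ) : Measure S :=
  ((N : ℝ≥0∞) + 1)⁻¹ • ∑ i ∈ Finset.range (N + 1), (κ ^ i) z

lemma cesaroLaw_apply (κ : Kernel S S) (z : S) (N : ℕ) (A : Set S) :
    cesaroLaw κ z N A = ((N : ℝ≥0∞) + 1)⁻¹ * ∑ i ∈ Finset.range (N + 1), (κ ^ i) z A := by
  simp [cesaroLaw]

lemma inv_mul_sum_range_const (N : ℕ) (c : ℝ≥0∞) :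
    ((N : ℝ≥0∞) + 1)⁻¹ * ∑ _i ∈ Finset.range (N + 1), c = c := by
  rw [Finset.sum_const, Finset.card_range, nsmul_eq_mul, Nat.cast_add, Nat.cast_one, ← mul_assoc,
    ENNReal.inv_mul_cancel (by simp) (by simp), one_mul]

lemma cesaroLaw_le {κ : Kernel S S} {z : S} {A : Set S} {c : ℝ≥0∞}
    (h : ∀ n, (κ ^ n) z A ≤ c) (N : ℕ) : cesaroLaw κ z N A ≤ c := by
  rw [cesaroLaw_apply, ← inv_mul_sum_range_const N c]
  gcongr
  exact h _

variable [DiscreteMeasurableSpace S]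

/-- The sum telescopes: one step trades the term of index 0 for that of index `N + 1`, which is at
most 1. -/
lemma bind_cesaroLaw_le (κ : Kernel S S) [IsMarkovKernel κ] (z : S) (N : ℕ) (A : Set S) :
    (cesaroLaw κ z N).bind κ A ≤ cesaroLaw κ z N A + ((N : ℝ≥0∞) + 1)⁻¹ := by
  have hM := fun n => isMarkovKernel_pow (κ := κ) n
  rw [Measure.bind_apply .of_discrete (Kernel.aemeasurable _), cesaroLaw, lintegral_smul_measure,
    lintegral_finsetSum_measure]
  simp only [← Kernel.pow_succ_apply_eq_lintegral κ _ z (MeasurableSet.of_discrete (s := A))]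
  rw [← cesaroLaw, cesaroLaw_apply, smul_eq_mul]
  calc ((N : ℝ≥0∞) + 1)⁻¹ * ∑ i ∈ Finset.range (N + 1), (κ ^ (i + 1)) z A
      ≤ ((N : ℝ≥0∞) + 1)⁻¹ * (∑ i ∈ Finset.range (N + 1), (κ ^ i) z A + 1) := by
        gcongr
        calc ∑ i ∈ Finset.range (N + 1), (κ ^ (i + 1)) z A
            ≤ ∑ i ∈ Finset.range (N + 1), (κ ^ (i + 1)) z A + (κ ^ 0) z A := le_self_add
          _ = ∑ i ∈ Finset.range (N + 1), (κ ^ i) z A + (κ ^ (N + 1)) z A := by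
            rw [← Finset.sum_range_succ' (fun i => (κ ^ i) z A), Finset.sum_range_succ]
          _ ≤ _ := by
            gcongr
            exact prob_le_one
    _ = _ := by rw [mul_add, mul_one]

/-- A tight chain has an invariant probability measure, carried by the states that the chain can
reach. -/
theorem exists_invariant_of_tight [Countable S] (κ : Kernel S S) [IsMarkovKernel κ] (z : S)
    (htight : ∀ ε : ℝ≥0∞, ε ≠ 0 → ∃ K : Finset S, ∀ n, (κ ^ n) z (K : Set S)ᶜ ≤ ε) :
    ∃ μ : Measure S, IsProbabilityMeasure μ ∧ Kernel.Invariant κ μ ∧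
      ∀ A : Set S, (∀ n, (κ ^ n) z A = 0) → μ A = 0 := by
  have hM := fun n => isMarkovKernel_pow (κ := κ) n
  -- A free ultrafilter gives limits at all states simultaneously, in place of a diagonal
  -- extraction.
  let U : Ultrafilter ℕ := hyperfilter ℕ
  have hlim : ∀ w, ∃ c, Tendsto (fun N => cesaroLaw κ z N {w}) U (𝓝 c) := fun w =>
    ⟨_, (U.map fun N => cesaroLaw κ z N {w}).le_nhds_lim⟩
  choose m hm using hlim
  let μ : Measure S := Measure.sum fun w => m w • Measure.dirac w
  have hμ : ∀ w, μ {w} = m w := fun w => by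
    rw [Measure.sum_apply _ .of_discrete, tsum_eq_single w]
    · simp
    · intro w' hw'
      simp [hw']
  have hfin : ∀ K : Finset S, Tendsto (fun N => cesaroLaw κ z N K) U (𝓝 (μ K)) := fun K => by
    simp only [← sum_measure_singleton, hμ]
    exact tendsto_finsetSum _ fun w _ => hm w
  have hle : μ Set.univ ≤ 1 := by
    have : μ Set.univ = ∑' w, m w := by
      rw [← tsum_congr hμ, ← measure_iUnion (fun i j hij => Set.disjoint_singleton.2 hij)
        fun s => measurableSet_singleton s, Set.iUnion_of_singleton]
    rw [this, ENNReal.tsum_eq_iSup_sum]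
    refine iSup_le fun K => ?_
    simp only [← hμ, sum_measure_singleton]
    exact le_of_tendsto' (hfin K) fun N => cesaroLaw_le (fun n => prob_le_one) N
  -- Tightness prevents mass from escaping in the limit.
  have hge : 1 ≤ μ Set.univ := by
    refine ENNReal.le_of_forall_pos_le_add fun ε hε _ => ?_
    obtain ⟨K, hK⟩ := htight ε (by simpa using hε.ne')
    have h₁ : ∀ N, 1 ≤ cesaroLaw κ z N K + ε := fun N => by
      calc (1 : ℝ≥0∞) = cesaroLaw κ z N Set.univ := by
            rw [cesaroLaw_apply]
            simp only [measure_univ, inv_mul_sum_range_const]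
        _ ≤ cesaroLaw κ z N K + cesaroLaw κ z N (K : Set S)ᶜ := by
            rw [measure_add_measure_compl .of_discrete]
        _ ≤ _ := by
            gcongr
            exact cesaroLaw_le hK N
    have h₂ : 1 ≤ μ K + ε := ge_of_tendsto' ((hfin K).add_const _) h₁
    exact h₂.trans (by gcongr; exact Set.subset_univ _)
  have hprob : IsProbabilityMeasure μ := ⟨le_antisymm hle hge⟩
  have hone : Tendsto (fun N : ℕ => ((N : ℝ≥0∞) + 1)⁻¹) U (𝓝 0) := by
    have h := ENNReal.tendsto_inv_nat_nhds_zero.comp (tendsto_add_atTop_nat 1)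
    refine Tendsto.mono_left (by simpa [Function.comp_def] using h) ?_
    exact Nat.hyperfilter_le_atTop
  -- Pointwise limits commute only with finite sums, hence only subinvariance here; equality follows
  -- because both measures have total mass 1.
  have hsub : ∀ w, μ.bind κ {w} ≤ μ {w} := fun w => by
    rw [Measure.bind_apply .of_discrete (Kernel.aemeasurable _), lintegral_countable',
      ENNReal.tsum_eq_iSup_sum]
    refine iSup_le fun K => ?_
    have hlim : Tendsto (fun N => ∑ v ∈ K, κ v {w} * cesaroLaw κ z N {v}) U
        (𝓝 (∑ v ∈ K, κ v {w} * μ {v})) := by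
      refine tendsto_finsetSum _ fun v _ => ?_
      rw [hμ]
      exact ENNReal.Tendsto.const_mul (hm v) (Or.inr (measure_ne_top _ _))
    have hlim' := (hm w).add hone
    rw [add_zero, ← hμ] at hlim'
    refine le_of_tendsto_of_tendsto' hlim hlim' fun N => ?_
    refine le_trans ?_ (bind_cesaroLaw_le κ z N {w})
    rw [Measure.bind_apply .of_discrete (Kernel.aemeasurable _), lintegral_countable']
    exact ENNReal.sum_le_tsum K
  refine ⟨μ, hprob, ?_, fun A hA => ?_⟩
  · refine Measure.eq_of_le_of_measure_univ_eq (Measure.le_iff.2 fun s hs => ?_) (by simp)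
    rw [← Measure.tsum_indicator_apply_singleton _ _ hs,
      ← Measure.tsum_indicator_apply_singleton μ _ hs]
    refine ENNReal.tsum_le_tsum fun w => ?_
    by_cases hw : w ∈ s
    · simpa only [Set.indicator_of_mem hw] using hsub w
    · simp [hw]
  · refine (measure_null_iff_singleton A.to_countable).2 fun w hw => ?_
    rw [hμ]
    refine tendsto_nhds_unique (hm w) (tendsto_const_nhds.congr fun N => ?_)
    refine (le_antisymm (cesaroLaw_le (fun n => ?_) N) zero_le).symm
    exact (measure_mono_null (by simpa using hw) (hA n)).le

end Cesaro

/-! ### From conditions 2 and 3 back to accordability -/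

section Approximation

variable {Ω : Type*} [mΩ : MeasurableSpace Ω]

/-- The union of an increasing sequence of σ-fields is an algebra, dense in measure in the σ-field
it generates. -/
lemma exists_measure_symmDiff_lt_of_iSup (P : Measure Ω) [IsFiniteMeasure P]
    {F : ℕ → MeasurableSpace Ω} (hF : ∀ n, F n ≤ mΩ) (hmono : Monotone F) {A : Set Ω}
    (hA : MeasurableSet[⨆ n, F n] A) {ε : ℝ≥0∞} (hε : ε ≠ 0) :
    ∃ n B, MeasurableSet[F n] B ∧ P (A ∆ B) < ε := by
  have hle : (⨆ n, F n) ≤ mΩ := iSup_le hF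
  have halg : IsSetAlgebra {B : Set Ω | ∃ n, MeasurableSet[F n] B} :=
    { empty_mem := ⟨0, @MeasurableSet.empty _ (F 0)⟩
      compl_mem := fun s ⟨n, hs⟩ => ⟨n, hs.compl⟩
      union_mem := fun s t ⟨n, hs⟩ ⟨k, ht⟩ => ⟨max n k,
        (hmono (le_max_left n k) _ hs).union (hmono (le_max_right n k) _ ht)⟩ }
  have hgen : (⨆ n, F n) = MeasurableSpace.generateFrom {B : Set Ω | ∃ n, MeasurableSet[F n] B} :=
    le_antisymm (iSup_le fun n s hs => MeasurableSpace.measurableSet_generateFrom ⟨n, hs⟩)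
      (MeasurableSpace.generateFrom_le fun s ⟨n, hs⟩ => le_iSup F n _ hs)
  have hfin : IsFiniteMeasure (P.trim hle) := isFiniteMeasure_trim hle
  have hdense := Measure.MeasureDense.of_generateFrom_isSetAlgebra_finite (m := ⨆ n, F n)
    (P.trim hle) halg hgen
  obtain ⟨r, hr, hrε⟩ := ENNReal.lt_iff_exists_nnreal_btwn.1 (pos_iff_ne_zero.2 hε)
  obtain ⟨B, ⟨n, hB⟩, hAB⟩ := @Measure.MeasureDense.approx Ω (⨆ n, F n) (P.trim hle) _ hdense A hA
    (@measure_ne_top Ω (⨆ n, F n) (P.trim hle) _ A) r (by simpa using hr)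
  refine ⟨n, B, hB, ?_⟩
  rw [trim_measurableSet_eq hle (hA.symmDiff (le_iSup F n _ hB)), ENNReal.ofReal_coe_nnreal] at hAB
  exact hAB.trans hrε

end Approximation

section Converse

variable {E : Type u} {G : Type v} [MeasurableSpace E] [Countable E] [DiscreteMeasurableSpace E]
  [MeasurableSpace G] {f : E × G → E} {β : Measure G} [IsProbabilityMeasure β]

/-- If the diagonal cannot be reached from `(x, y)`, the coupled kernel has an invariant probability
measure that does not charge the diagonal. -/
lemma exists_invariant_off_diagonal (hf : Measurable f) {π : Measure E} [IsFiniteMeasure π]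
    (hπ : Kernel.Invariant (recursionKernel f β) π) {x y : E} (hx : π {x} ≠ 0) (hy : π {y} ≠ 0)
    (h : ¬ Accordable f β x y) :
    ∃ μ : Measure (E × E), IsProbabilityMeasure μ ∧
      Kernel.Invariant (recursionKernel (coupledMap f) β) μ ∧ μ (Set.diagonal E) = 0 := by
  have := isMarkovKernel_recursionKernel (β := β) (measurable_coupledMap hf)
  obtain ⟨μ, hμ, hinv, hnull⟩ := exists_invariant_of_tight (recursionKernel (coupledMap f) β) (x, y)
    fun ε hε => exists_finset_coupled_pow_compl_le hf hπ (z := (x, y)) hx hy hε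
  refine ⟨μ, hμ, hinv, hnull _ fun n => ?_⟩
  by_contra hn
  refine h ⟨n + 1, by lia, (pos_iff_ne_zero.2 hn).trans_le ?_⟩
  exact coupled_pow_diagonal_mono hf (x, y) n.le_succ

theorem accordable_of_ae_mem_diagonal (hf : Measurable f) {π : Measure E} [IsFiniteMeasure π]
    (hπ : Kernel.Invariant (recursionKernel f β) π) (hpos : ∀ x, π {x} ≠ 0)
    (h : ∀ (Ω : Type (max u v)) [MeasurableSpace Ω] (P : Measure Ω) [IsProbabilityMeasure P]
      (Z : ℤ → Ω → E × E), IsMarkovChain P (recursionKernel (coupledMap f) β) Z →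
      IsStationary P Z → ∀ᵐ ω ∂P, ∀ n : ℤ, Z n ω ∈ Set.diagonal E) (x y : E) :
    Accordable f β x y := by
  by_contra hxy
  obtain ⟨μ, hμ, hinv, hD⟩ := exists_invariant_off_diagonal hf hπ (hpos x) (hpos y) hxy
  have hg := measurable_coupledMap hf
  obtain ⟨Ω, _, P, hP, Z, V, hgov, hstat, hlaw⟩ := exists_isGoverned hg hinv
  have hae := h Ω P Z (hgov.isMarkovChain hg) hstat
  rw [← hlaw 0, Measure.map_apply (hgov.measurable_chain 0) .of_discrete] at hD
  have hbot : ∀ᵐ ω ∂P, False := by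
    filter_upwards [hae, measure_eq_zero_iff_ae_notMem.1 hD] with ω h₁ h₂
    exact h₂ (h₁ 0)
  exact hbot.exists.elim fun _ => id

theorem accordable_of_completedPast_le (hf : Measurable f) {π : Measure E} [IsProbabilityMeasure π]
    (hπ : Kernel.Invariant (recursionKernel f β) π) (hpos : ∀ x, π {x} ≠ 0)
    (h : ∀ (Ω : Type (max u v)) [MeasurableSpace Ω] (P : Measure Ω) [IsProbabilityMeasure P]
      (X : ℤ → Ω → E) (V : ℤ → Ω → G), IsGoverned P f β X V → IsStationary P X →
      ∀ n : ℤ, completedPast P X n ≤ completedPast P V n) (x y : E) :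
    Accordable f β x y := by
  obtain ⟨Ω, mΩ, P, hP, X, V, hgov, hstat, hlaw⟩ := exists_isGoverned hf hπ
  set H : Set Ω := X 0 ⁻¹' {x} with hH
  -- Generated by the innovations at times `-m + 1, …, 0`.
  set F : ℕ → MeasurableSpace Ω := fun m =>
    ⨆ i : ℕ, ⨆ _ : i < m, MeasurableSpace.comap (V (-m + i + 1)) inferInstance with hF
  have hFle : ∀ m, F m ≤ mΩ := fun m =>
    iSup₂_le fun i _ => (hgov.measurable_innovation _).comap_le
  have hFmono : Monotone F := fun m m' hmm' => iSup₂_le fun i hi =>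
    le_iSup₂_of_le (f := fun (i : ℕ) (_ : i < m') =>
        MeasurableSpace.comap (V (-m' + i + 1)) inferInstance) (i + (m' - m)) (by lia)
      (by rw [show (-(m' : ℤ) + ((i + (m' - m) : ℕ) : ℤ) + 1) = -m + i + 1 by lia])
  have hpastF : past V 0 ≤ ⨆ m, F m := iSup₂_le fun k hk =>
    le_iSup_of_le (1 - k).toNat (le_iSup₂_of_le (f := fun (i : ℕ) (_ : i < (1 - k).toNat) =>
        MeasurableSpace.comap (V (-((1 - k).toNat : ℕ) + i + 1)) inferInstance) 0 (by lia)
      (by rw [show (-(((1 - k).toNat : ℕ) : ℤ) + ((0 : ℕ) : ℤ) + 1) = k by lia]))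
  obtain ⟨A, hA, hHA⟩ : ∃ A, MeasurableSet[past V 0] A ∧ H =ᵐ[P] A :=
    h Ω P X V hgov hstat 0 _ ⟨H, measurable_past le_rfl (measurableSet_singleton x), .rfl⟩
  -- The total error will be `ε * C`, from `H` and from the two starting states; `ε` makes it half
  -- of `π {x}`.
  set C : ℝ≥0∞ := 1 + (π {x})⁻¹ + (π {y})⁻¹ with hC
  have hCtop : C ≠ ∞ := by simp [hC, hpos]
  have hC0 : C ≠ 0 := by simp [hC]
  obtain ⟨m, B, hB, hAB⟩ := exists_measure_symmDiff_lt_of_iSup P hFle hFmono (hpastF _ hA)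
    (ε := π {x} / 2 / C) (by simp [hpos, hCtop])
  set ε := π {x} / 2 / C
  have hHB : P (H ∆ B) ≤ ε := by
    rw [measure_congr (hHA.symmDiff (ae_eq_refl B))]
    exact hAB.le
  set O : E → Ω → E := fun z ω => orbit f (fun i => V (-m + i + 1) ω) z m with hO
  have hOF : ∀ z, Measurable[F m] (O z) := fun z =>
    measurable_orbit (m := F m) hf measurable_const m fun i hi => measurable_iff_comap_le.2
      (le_iSup₂_of_le (f := fun (i : ℕ) (_ : i < m) =>
        MeasurableSpace.comap (V (-m + i + 1)) inferInstance) i hi le_rfl)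
  -- On `{X (-m) = z}` the orbit of `z` is the chain itself, so its error is part of `H ∆ B`;
  -- independence from `X (-m)` removes this conditioning at the cost of `(π {z})⁻¹`.
  have hbad : ∀ z, P ((O z ⁻¹' {x}) ∆ B) ≤ (π {z})⁻¹ * ε := by
    intro z
    rw [← ENNReal.mul_le_iff_le_inv (hpos z) (measure_ne_top _ _), ← hlaw (-m),
      Measure.map_apply (hgov.measurable_chain _) .of_discrete,
      ← (Indep_iff _ _ _).1 (hgov.indep_future (-m) m) _ _
        (measurable_chain_past le_rfl (measurableSet_singleton z))
        (((hOF z) (measurableSet_singleton x)).symmDiff hB)]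
    refine le_trans (measure_mono_ae ?_) hHB
    filter_upwards [hgov.ae_eq_orbit (-m) m] with ω hω
    rintro ⟨hz, hsymm⟩
    have hz' : X (-m) ω = z := hz
    rw [neg_add_cancel, hz'] at hω
    change ω ∈ H ∆ B
    rw [Set.mem_symmDiff] at hsymm ⊢
    rw [hH, Set.mem_preimage, hω]
    exact hsymm
  have hmerge : P {ω | O x ω = O y ω}
      = (recursionKernel (coupledMap f) β ^ m) (x, y) (Set.diagonal E) := by
    have hlawO := hgov.map_orbit (measurable_coupledMap hf) (n := -m) (Z := fun _ => (x, y))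
      measurable_const m
    rw [Measure.map_const, measure_univ, one_smul,
      Measure.dirac_bind (Kernel.measurable _)] at hlawO
    rw [← hlawO, Measure.map_apply _ .of_discrete]
    · congr 1
      ext ω
      change _ ↔ orbit (coupledMap f) _ _ m ∈ Set.diagonal E
      rw [orbit_coupledMap]
      rfl
    · exact measurable_orbit (measurable_coupledMap hf) measurable_const m
        fun i _ => hgov.measurable_innovation _
  have hsub : H ⊆ H ∆ B ∪ (O x ⁻¹' {x}) ∆ B ∪ (O y ⁻¹' {x}) ∆ B ∪ {ω | O x ω = O y ω} := by
    intro ω hω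
    by_contra hnot
    simp only [Set.mem_union, Set.mem_symmDiff, not_or, Set.mem_preimage, Set.mem_singleton_iff,
      Set.mem_ofPred_eq] at hnot
    obtain ⟨⟨⟨⟨h₁, -⟩, -, h₂⟩, -, h₃⟩, h₄⟩ := hnot
    have hωB : ω ∈ B := by
      by_contra hωB
      exact h₁ ⟨hω, hωB⟩
    have hx' : O x ω = x := by
      by_contra hne
      exact h₂ ⟨hωB, hne⟩
    have hy' : O y ω = x := by
      by_contra hne
      exact h₃ ⟨hωB, hne⟩
    exact h₄ (hx'.trans hy'.symm)
  have hle : π {x} ≤ π {x} / 2 + P {ω | O x ω = O y ω} := by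
    calc π {x} = P H := by
          rw [← hlaw 0, Measure.map_apply (hgov.measurable_chain _) .of_discrete]
      _ ≤ ε + (π {x})⁻¹ * ε + (π {y})⁻¹ * ε + P {ω | O x ω = O y ω} := by
          refine (measure_mono hsub).trans ((measure_union_le _ _).trans (add_le_add_left ?_ _))
          refine (measure_union_le _ _).trans (add_le_add ?_ (hbad y))
          exact (measure_union_le _ _).trans (add_le_add hHB (hbad x))
      _ = ε * C + P {ω | O x ω = O y ω} := by rw [hC]; ring
      _ = _ := by rw [ENNReal.div_mul_cancel hC0 hCtop]
  have hne : P {ω | O x ω = O y ω} ≠ 0 := fun h0 => by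
    rw [h0, add_zero] at hle
    exact absurd hle (not_le.2 (ENNReal.half_lt_self (hpos x) (measure_ne_top _ _)))
  rw [hmerge] at hne
  refine ⟨m + 1, by lia, (pos_iff_ne_zero.2 hne).trans_le ?_⟩
  exact coupled_pow_diagonal_mono hf (x, y) m.le_succ

end Converse

end ConstructiveChain

theorem mainTheorem1 {E : Type u} {G : Type v}
    [MeasurableSpace E] [Countable E] [DiscreteMeasurableSpace E] [MeasurableSpace G]
    (f : E × G → E) (hf : Measurable f) (β : Measure G) [IsProbabilityMeasure β]
    (hirr : Kernel.IsIrreducible Measure.count (ConstructiveChain.recursionKernel f β))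
    (hpos : ConstructiveChain.IsPositiveRecurrent (ConstructiveChain.recursionKernel f β)) :
    List.TFAE [
      (∀ x y : E, ConstructiveChain.Accordable f β x y),
      (∀ (Ω : Type (max u v)) [MeasurableSpace Ω] (P : Measure Ω) [IsProbabilityMeasure P]
        (X : ℤ → Ω → E) (V : ℤ → Ω → G),
        ConstructiveChain.IsGoverned P f β X V → ConstructiveChain.IsStationary P X →
        ∀ n : ℤ, ConstructiveChain.completedPast P X n ≤ ConstructiveChain.completedPast P V n),
      (∀ (Ω : Type (max u v)) [MeasurableSpace Ω] (P : Measure Ω) [IsProbabilityMeasure P]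
        (Z : ℤ → Ω → E × E),
        ConstructiveChain.IsMarkovChain P
          (ConstructiveChain.recursionKernel (ConstructiveChain.coupledMap f) β) Z →
        ConstructiveChain.IsStationary P Z →
        ∀ᵐ ω ∂P, ∀ n : ℤ, Z n ω ∈ Set.diagonal E)] := by
  have := ConstructiveChain.isMarkovKernel_recursionKernel hf (β := β)
  -- Asking for a point covers empty `E`, which has no probability measure.
  have hπ : ∀ _ : E, ∃ π : Measure E, IsProbabilityMeasure π ∧
      Kernel.Invariant (ConstructiveChain.recursionKernel f β) π ∧ ∀ x, π {x} ≠ 0 := fun x => by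
    have : Nonempty E := ⟨x⟩
    obtain ⟨π, hπ, hinv⟩ := ConstructiveChain.exists_invariant_of_isPositiveRecurrent _ hpos
    exact ⟨π, hπ, hinv, fun x =>
      (ConstructiveChain.measure_singleton_pos_of_irreducible hirr hinv x).ne'⟩
  tfae_have 1 → 2 := fun h Ω _ P _ X V hX hstat n =>
    ConstructiveChain.completedPast_le_of_accordable hf h hX hstat n
  tfae_have 1 → 3 := fun h Ω _ P _ Z hZ hstat =>
    ConstructiveChain.ae_mem_diagonal_of_accordable hf h hZ hstat
  tfae_have 2 → 1 := fun h x y => by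
    obtain ⟨π, _, hinv, hne⟩ := hπ x
    exact ConstructiveChain.accordable_of_completedPast_le hf hinv hne h x y
  tfae_have 3 → 1 := fun h x y => by
    obtain ⟨π, _, hinv, hne⟩ := hπ x
    exact ConstructiveChain.accordable_of_ae_mem_diagonal hf hinv hne h x y
  tfae_finish
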